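/- Let $k\ge 1$ and $n\ge 0$ be integers. For $P$ in the set $\mathcal M_k$ of probability vectors $P=(p_1,\dots,p_k)$ and $\phi:[0,1]\to\mathbb R$ put $\theta(P;\phi)=\sum_{i=1}^k\phi(p_i)$. For real $m\ge 0$ let the Poissonized minimax risk be $$\tilde R^*(m,k;\phi)=\inf_{\hat\theta}\ \sup_{P\in\mathcal M_k}\ \mathbb E\big[(\hat\theta(\tilde N)-\theta(P;\phi))^2\big],$$ where $\tilde N=(\tilde N_1,\dots,\tilde N_k)$ has independent coordinates $\tilde N_i\sim\mathrm{Poi}(m p_i)$ and the infimum is over all functions $\hat\theta:\{0,1,2,\dots\}^k\to\mathbb R$. For $0<\beta\le 1$ and $f:[0,1]\to\mathbb R$ let $\|f\|_{C^{0,\beta}}=\sup_{x\ne y\in[0,1]}|f(x)-f(y)|/|x-y|^{\beta}$; $f$ is $\beta$-Hölder continuous if this is finite, and Lipschitz continuous if it is $1$-Hölder continuous. For an interval $I$ let $E_L(f,I)=\inf_g\sup_{x\in I}|f(x)-g(x)|$, the infimum being over real polynomials $g$ of degree at most $L$. **Theorem.** Let $1<\alpha\le 2$. Suppose that $\phi:[0,1]\to\mathbb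 R$ is Lipschitz continuous with $\phi(0)=0$, and that $\phi$ is differentiable on $[0,1]$ (one-sidedly at the end points) with $\phi^{(1)}$ being $(\alpha-1)$-Hölder continuous and $\phi^{(1)}(0)=0$. Let $\phi^\star(p)=\phi(p)/p$. Let $L>0$ be an integer, $\lambda\le k$ a real number, and $\gamma\in(0,1)$ with $\gamma\le\lambda/k$ and $k\gamma\le 1$, and put $d=2k\gamma\,E_L(\phi^\star,[\gamma,\lambda/k])$. If $\lambda/\sqrt k<1/12$, then $$\tilde R^*(n/2,k;\phi)\ \ge\ \frac{d^2}{32}\left(\frac78-k\Big(\frac{2en\lambda}{kL}\Big)^{L}-\frac{32\,\|\phi^{(1)}\|_{C^{0,\alpha-1}}^2\lambda^{2\alpha}}{k^{2\alpha-1}d^2}-\frac{128\,\|\phi\|_{C^{0,1}}^2e^{-n/32}}{d^2}-\frac{512\,\|\phi\|_{C^{0,1}}^2\lambda^2}{k\,d^2}\right),$$ where for $d=0$ the right-hand side is read as $0$. -/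

import Mathlib

open MeasureTheory ProbabilityTheory Set
open scoped NNReal ENNReal

namespace AdditiveFunctional

/-- The additive functional `θ(P; φ) = ∑ i, φ (p i)`. -/
noncomputable def theta {k : ℕ} (φ : ℝ → ℝ) (P : Fin k → ℝ) : ℝ := ∑ i, φ (P i)

/-- The law of the Poissonized histogram: independent counts, the `i`-th one being Poisson
distributed with mean `m * P i`. -/
noncomputable def histogramLaw {k : ℕ} (m : ℝ) (P : Fin k → ℝ) : Measure (Fin k → ℕ) :=
  Measure.pi fun i => poissonMeasure (Real.toNNReal (m * P i))

/-- The mean squared error at `P` of an estimator of `θ` based on the Poissonized histogram. -/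
noncomputable def poissonRisk {k : ℕ} (m : ℝ) (φ : ℝ → ℝ) (est : (Fin k → ℕ) → ℝ)
    (P : Fin k → ℝ) : ℝ≥0∞ :=
  ∫⁻ N, ENNReal.ofReal ((est N - theta φ P) ^ 2) ∂(histogramLaw m P)

/-- The Poissonized minimax risk with (real) sample size parameter `m` and alphabet size `k`:
infimum over all estimators of the supremum over all probability vectors of length `k`. -/
noncomputable def poissonMinimaxRisk (m : ℝ) (k : ℕ) (φ : ℝ → ℝ) : ℝ≥0∞ :=
  ⨅ est : (Fin k → ℕ) → ℝ, ⨆ P ∈ stdSimplex ℝ (Fin k), poissonRisk m φ est P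

/-- The error of the best uniform approximation of `f` on `I` by real polynomials of degree at
most `L`. It is computed in `[0, ∞]`, so that an unbounded error counts as `∞` in the infimum. -/
noncomputable def bestApproxError (L : ℕ) (f : ℝ → ℝ) (I : Set ℝ) : ℝ :=
  (⨅ g : {g : Polynomial ℝ // g.natDegree ≤ L},
    ⨆ x ∈ I, ENNReal.ofReal |f x - g.1.eval x|).toReal

/-- `f` is `β`-Hölder continuous on `[0, 1]`. -/
def IsHolderOnUnit (β : ℝ) (f : ℝ → ℝ) : Prop :=
  MemHolder (Real.toNNReal β) ((Icc (0 : ℝ) 1).domRestrict f)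

/-- The `β`-Hölder seminorm of `f` on `[0, 1]`, that is, the supremum of
`|f x - f y| / |x - y| ^ β` over distinct points of `[0, 1]`, for `f` that is `β`-Hölder. -/
noncomputable def holderSeminorm (β : ℝ) (f : ℝ → ℝ) : ℝ :=
  (nnHolderNorm (Real.toNNReal β) ((Icc (0 : ℝ) 1).domRestrict f) : ℝ)

/-- The first derivative on `[0, 1]`, one-sided at the end points. -/
noncomputable def unitDeriv (φ : ℝ → ℝ) : ℝ → ℝ := derivWithin φ (Icc 0 1)

end AdditiveFunctional

/-!
The lower bound is obtained by the method of two priors, with priors supported on the simplex itself.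

Put `M = λ / k` and `E = E_L(φ⋆, [γ, M])`. By duality (`exists_moment_matching_weights`) there are two
finitely supported probability measures on `[γ, M]` with the same moments up to the order `L` whose
integrals of `φ⋆` differ by nearly `2 E`. Reweighting them by `(γ / 2) / x` and putting the missing
mass at `0` gives two laws of mean `γ / 2` on `{0} ∪ [γ, M]`, still with matched moments, whose
integrals of `φ` differ by nearly `γ E` (`exists_matching_priors`). Draw `k - 1` coordinates
`U 1, …, U (k - 1)` independently from one of these laws, discard the draws with `∑ U i > 1`, and let
one more coordinate carry the remaining mass `1 - ∑ U i`. Since the expected sum is at most `1 / 2`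
and each coordinate is at most `M`, discarded draws are exponentially rare in `1 / M`.

The compensating coordinate makes the counts dependent, but harmlessly so: for `U` and a remaining
mass `c`, the joint mass `exp (-m U) (m U) ^ i / i! * exp (-m (c - U)) (m (c - U)) ^ y / y!` is
`exp (-m c)` times a polynomial in `U`, and expanding the last power around `m c` shows that swapping
one prior for the other costs at most the tail of `exp (2 m M)` beyond the order `L`, uniformly in
`c` (`sum_abs_compensated_le`). Swapping the coordinates one at a time bounds the total variation
between the two truncated mixtures (`sum_abs_truncatedMixture_sub_le`); the draws for which the
truncation interferes are controlled by exponential moments. All sums are over finite boxes of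
counts, which are exhausted only at the very end.

The value of the functional under either prior is concentrated around its mean: the variance of
`∑ φ (U i)` is controlled by `|φ p| ≤ ‖φ'‖ p ^ α`, and the compensating coordinate contributes at most
`‖φ‖ ^ 2` times the variance of `∑ U i`, by the Lipschitz property. Comparing the risks under the two
priors gives the bound (`two_prior_bound`, `risk_lower_bound`). Because `d ≤ 2 λ ‖φ‖`, the bracket in
the claim is positive only if `k > 146`, which absorbs the coordinate spent on compensation.
-/

namespace AdditiveFunctional

/-! ### Poisson weights and sums over product alphabets -/

/-- The mass `exp (-a) * a ^ j / j!` that the Poisson law of mean `a` gives to `j`. -/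
noncomputable def poissonWeight (a : ℝ) (j : ℕ) : ℝ := Real.exp (-a) * (a ^ j / j.factorial)

lemma poissonWeight_nonneg {a : ℝ} (ha : 0 ≤ a) (j : ℕ) : 0 ≤ poissonWeight a j := by
  unfold poissonWeight; positivity

lemma sum_range_poissonWeight_le_one {a : ℝ} (ha : 0 ≤ a) (B : ℕ) :
    ∑ j ∈ Finset.range B, poissonWeight a j ≤ 1 := by
  unfold poissonWeight
  rw [← Finset.mul_sum]
  calc Real.exp (-a) * ∑ j ∈ Finset.range B, a ^ j / (j.factorial : ℝ)
      ≤ Real.exp (-a) * Real.exp a := by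
        gcongr; exact Real.sum_le_exp_of_nonneg ha B
    _ = 1 := by rw [← Real.exp_add]; simp

lemma sum_fin_poissonWeight_le_one {a : ℝ} (ha : 0 ≤ a) (B : ℕ) :
    ∑ j : Fin B, poissonWeight a j ≤ 1 := by
  rw [Fin.sum_univ_eq_sum_range (poissonWeight a) B]
  exact sum_range_poissonWeight_le_one ha B

lemma sum_fin_cons {β : Type*} [Fintype β] {K : ℕ} (F : (Fin (K + 1) → β) → ℝ) :
    ∑ u, F u = ∑ a, ∑ u : Fin K → β, F (Fin.cons a u) := by
  rw [← (Fin.consEquiv fun _ : Fin (K + 1) => β).sum_comp, Fintype.sum_prod_type]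
  rfl

lemma sum_prod_poissonWeight_le_one {K : ℕ} {a : Fin K → ℝ} (ha : ∀ i, 0 ≤ a i) (B : ℕ) :
    ∑ N : Fin K → Fin B, ∏ i, poissonWeight (a i) (N i) ≤ 1 := by
  have h := Finset.prod_univ_sum (fun _ : Fin K => (Finset.univ : Finset (Fin B)))
    (fun i j => poissonWeight (a i) j)
  rw [Fintype.piFinset_univ] at h
  rw [← h]
  exact Finset.prod_le_one (fun i _ => Finset.sum_nonneg fun j _ => poissonWeight_nonneg (ha i) _)
    fun i _ => sum_fin_poissonWeight_le_one (ha i) B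

/-! ### Swapping one coordinate: moment matching with a compensating coordinate -/

/-- As a function of `x`, the joint mass of counts `i` and `y` of means `x` and `c - x` is
`exp (-c)` times a polynomial. -/
lemma poissonWeight_mul_compensated (x c : ℝ) (i y : ℕ) :
    poissonWeight x i * poissonWeight (c - x) y =
      ∑ p ∈ Finset.HasAntidiagonal.antidiagonal y, poissonWeight c p.2 *
        ((-1) ^ p.1 * (x ^ (i + p.1) / (i.factorial * p.1.factorial))) := by
  have hexp : Real.exp (-x) * Real.exp (-(c - x)) = Real.exp (-c) := by
    rw [← Real.exp_add]; ring_nf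
  have hbin : (c - x) ^ y / (y.factorial : ℝ) = ∑ p ∈ Finset.HasAntidiagonal.antidiagonal y,
      (-x) ^ p.1 / p.1.factorial * (c ^ p.2 / p.2.factorial) := by
    rw [show c - x = -x + c by ring, (Commute.all (-x) c).add_pow', Finset.sum_div]
    refine Finset.sum_congr rfl fun p hp => ?_
    rw [Finset.HasAntidiagonal.mem_antidiagonal] at hp
    have hc : (y.choose p.1 : ℝ) * p.1.factorial * p.2.factorial = y.factorial := by
      rw [← hp, Nat.choose_symm_add]; exact_mod_cast Nat.add_choose_mul_factorial_mul_factorial p.1 p.2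
    rw [nsmul_eq_mul, ← hc]
    have h1 : (p.1.factorial : ℝ) ≠ 0 := by positivity
    have h2 : (p.2.factorial : ℝ) ≠ 0 := by positivity
    have h3 : (y.choose p.1 : ℝ) ≠ 0 := by
      rw [← hp]; exact_mod_cast (Nat.choose_pos (Nat.le_add_right _ _)).ne'
    field_simp
  unfold poissonWeight
  rw [mul_mul_mul_comm, hexp, hbin, Finset.mul_sum, Finset.mul_sum]
  refine Finset.sum_congr rfl fun p _ => ?_
  rw [neg_pow, pow_add]
  have h1 : (p.1.factorial : ℝ) ≠ 0 := by positivity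
  have h2 : (p.2.factorial : ℝ) ≠ 0 := by positivity
  have h3 : (i.factorial : ℝ) ≠ 0 := by positivity
  field_simp

lemma sum_range_antidiagonal_le {F : ℕ → ℕ → ℝ} (hF : ∀ i j, 0 ≤ F i j) (B : ℕ) :
    ∑ y ∈ Finset.range B, ∑ p ∈ Finset.HasAntidiagonal.antidiagonal y, F p.1 p.2 ≤
      ∑ i ∈ Finset.range B, ∑ j ∈ Finset.range B, F i j := by
  simp_rw [Finset.Nat.sum_antidiagonal_eq_sum_range_succ F, Nat.succ_eq_add_one]
  rw [Finset.sum_range_diag_flip]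
  refine Finset.sum_le_sum fun i _ => Finset.sum_le_sum_of_subset_of_nonneg ?_ fun _ _ _ => hF _ _
  exact Finset.range_mono (Nat.sub_le _ _)

lemma sum_range_range_le_antidiagonal {F : ℕ → ℕ → ℝ} (hF : ∀ i j, 0 ≤ F i j) (B : ℕ) :
    ∑ i ∈ Finset.range B, ∑ j ∈ Finset.range B, F i j ≤
      ∑ y ∈ Finset.range (2 * B), ∑ p ∈ Finset.HasAntidiagonal.antidiagonal y, F p.1 p.2 := by
  simp_rw [Finset.Nat.sum_antidiagonal_eq_sum_range_succ F, Nat.succ_eq_add_one]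
  rw [Finset.sum_range_diag_flip]
  calc ∑ i ∈ Finset.range B, ∑ j ∈ Finset.range B, F i j
      ≤ ∑ i ∈ Finset.range B, ∑ j ∈ Finset.range (2 * B - i), F i j := by
        refine Finset.sum_le_sum fun i hi =>
          Finset.sum_le_sum_of_subset_of_nonneg ?_ fun _ _ _ => hF _ _
        rw [Finset.mem_range] at hi
        exact Finset.range_mono (by omega)
    _ ≤ _ := Finset.sum_le_sum_of_subset_of_nonneg (Finset.range_mono (by omega))
        fun _ _ _ => Finset.sum_nonneg fun _ _ => hF _ _

lemma sum_antidiagonal_pow_div_factorial (M : ℝ) (l : ℕ) :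
    ∑ p ∈ Finset.HasAntidiagonal.antidiagonal l,
      M ^ (p.1 + p.2) / ((p.1.factorial : ℝ) * p.2.factorial) = (2 * M) ^ l / l.factorial := by
  rw [two_mul, (Commute.all M M).add_pow', Finset.sum_div]
  refine Finset.sum_congr rfl fun p hp => ?_
  rw [Finset.HasAntidiagonal.mem_antidiagonal] at hp
  have hc : (l.choose p.1 : ℝ) * p.1.factorial * p.2.factorial = l.factorial := by
    rw [← hp, Nat.choose_symm_add]; exact_mod_cast Nat.add_choose_mul_factorial_mul_factorial p.1 p.2
  have h1 : (p.1.factorial : ℝ) ≠ 0 := by positivity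
  have h2 : (p.2.factorial : ℝ) ≠ 0 := by positivity
  have h3 : (l.choose p.1 : ℝ) ≠ 0 := by
    rw [← hp]; exact_mod_cast (Nat.choose_pos (Nat.le_add_right _ _)).ne'
  rw [nsmul_eq_mul, ← hc, pow_add]
  field_simp

variable {ι : Type*} [Fintype ι]

/-- If the signed weights `v` annihilate all powers of `x` up to the order `L`, then the signed
mixture of the laws of two independent counts of means `x a` and `c - x a` has total mass at most
the tail of the exponential series at `2 * M` beyond `L`, whatever `c ≥ 0` is. In particular the
compensating coordinate costs no factor depending on `c`. -/
lemma sum_abs_compensated_le {v x : ι → ℝ} {M ε c : ℝ} {L : ℕ}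
    (hM : 0 ≤ M) (hv0 : ∀ l ≤ L, ∑ a, v a * x a ^ l = 0)
    (hvM : ∀ l, |∑ a, v a * x a ^ l| ≤ M ^ l)
    (hε : ∀ n, ∑ l ∈ Finset.range n, (if l ≤ L then 0 else (2 * M) ^ l / (l.factorial : ℝ)) ≤ ε)
    (hc : 0 ≤ c) (B : ℕ) :
    ∑ i ∈ Finset.range B, ∑ y ∈ Finset.range B,
      |∑ a, v a * (poissonWeight (x a) i * poissonWeight (c - x a) y)| ≤ ε := by
  set b : ℕ → ℕ → ℝ := fun i j => if i + j ≤ L then 0 else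
    M ^ (i + j) / ((i.factorial : ℝ) * j.factorial) with hb
  have hb0 : ∀ i j, 0 ≤ b i j := fun i j => by
    simp only [hb]; split_ifs <;> positivity
  have hpoint : ∀ i y, |∑ a, v a * (poissonWeight (x a) i * poissonWeight (c - x a) y)| ≤
      ∑ p ∈ Finset.HasAntidiagonal.antidiagonal y, b i p.1 * poissonWeight c p.2 := by
    intro i y
    have hswap : ∑ a, v a * (poissonWeight (x a) i * poissonWeight (c - x a) y) =
        ∑ p ∈ Finset.HasAntidiagonal.antidiagonal y, poissonWeight c p.2 * ((-1) ^ p.1 *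
          ((∑ a, v a * x a ^ (i + p.1)) / (i.factorial * p.1.factorial))) := by
      simp_rw [poissonWeight_mul_compensated, Finset.mul_sum]
      rw [Finset.sum_comm]
      refine Finset.sum_congr rfl fun p _ => ?_
      rw [Finset.sum_div, Finset.mul_sum, Finset.mul_sum]
      exact Finset.sum_congr rfl fun a _ => by ring
    rw [hswap]
    refine (Finset.abs_sum_le_sum_abs _ _).trans (Finset.sum_le_sum fun p _ => ?_)
    rw [abs_mul, abs_mul, abs_pow, abs_neg, abs_one, one_pow, one_mul,
      abs_of_nonneg (poissonWeight_nonneg hc _), mul_comm]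
    refine mul_le_mul_of_nonneg_right ?_ (poissonWeight_nonneg hc _)
    simp only [hb]
    split_ifs with h
    · rw [hv0 _ h]; simp
    · rw [abs_div, abs_of_pos (a := (i.factorial : ℝ) * p.1.factorial) (by positivity)]
      gcongr
      exact hvM _
  calc ∑ i ∈ Finset.range B, ∑ y ∈ Finset.range B,
        |∑ a, v a * (poissonWeight (x a) i * poissonWeight (c - x a) y)|
      ≤ ∑ i ∈ Finset.range B, ∑ y ∈ Finset.range B,
          ∑ p ∈ Finset.HasAntidiagonal.antidiagonal y, b i p.1 * poissonWeight c p.2 :=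
        Finset.sum_le_sum fun i _ => Finset.sum_le_sum fun y _ => hpoint i y
    _ ≤ ∑ i ∈ Finset.range B, ∑ j ∈ Finset.range B, b i j := by
        refine Finset.sum_le_sum fun i _ => ?_
        refine (sum_range_antidiagonal_le (F := fun j r => b i j * poissonWeight c r)
          (fun j r => mul_nonneg (hb0 _ _) (poissonWeight_nonneg hc _)) B).trans ?_
        refine Finset.sum_le_sum fun j _ => ?_
        rw [← Finset.mul_sum]
        exact mul_le_of_le_one_right (hb0 _ _) (sum_range_poissonWeight_le_one hc B)
    _ ≤ ∑ l ∈ Finset.range (2 * B), ∑ p ∈ Finset.HasAntidiagonal.antidiagonal l, b p.1 p.2 :=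
        sum_range_range_le_antidiagonal hb0 B
    _ = ∑ l ∈ Finset.range (2 * B), (if l ≤ L then 0 else (2 * M) ^ l / (l.factorial : ℝ)) := by
        refine Finset.sum_congr rfl fun l _ => ?_
        rw [← sum_antidiagonal_pow_div_factorial]
        split_ifs with h
        · refine Finset.sum_eq_zero fun p hp => ?_
          rw [Finset.HasAntidiagonal.mem_antidiagonal] at hp
          simp only [hb]; rw [if_pos (by omega)]
        · refine Finset.sum_congr rfl fun p hp => ?_
          rw [Finset.HasAntidiagonal.mem_antidiagonal] at hp
          simp only [hb]; rw [if_neg (by omega)]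
    _ ≤ ε := hε _

/-! ### Total variation between the truncated mixtures -/

/-- The mass at the counts `(y, N)` of a truncated Poisson mixture. The rates are `m * x (u i)` for
the counts `N i`, with the atoms `u i` drawn independently with weights `w`, and
`m * (c - ∑ i, x (u i))` for the compensating count `y`; draws for which the latter rate would be
negative are discarded, so that the total mass may be less than one. -/
noncomputable def truncatedMixture (m : ℝ) (x w : ι → ℝ) {K : ℕ} (c : ℝ) (N : Fin K → ℕ)
    (y : ℕ) : ℝ :=
  ∑ u : Fin K → ι, (∏ i, w (u i)) * if ∑ i, x (u i) ≤ c then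
    (∏ i, poissonWeight (m * x (u i)) (N i)) * poissonWeight (m * (c - ∑ i, x (u i))) y else 0

lemma truncatedMixture_nonneg {m : ℝ} {x w : ι → ℝ} (hm : 0 ≤ m) (hx : ∀ a, 0 ≤ x a)
    (hw : ∀ a, 0 ≤ w a) {K : ℕ} (c : ℝ) (N : Fin K → ℕ) (y : ℕ) :
    0 ≤ truncatedMixture m x w c N y := by
  refine Finset.sum_nonneg fun u _ => mul_nonneg (Finset.prod_nonneg fun i _ => hw _) ?_
  split_ifs with h
  · exact mul_nonneg (Finset.prod_nonneg fun i _ => poissonWeight_nonneg (mul_nonneg hm (hx _)) _)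
      (poissonWeight_nonneg (mul_nonneg hm (sub_nonneg.2 h)) _)
  · exact le_rfl

lemma truncatedMixture_cons (m : ℝ) (x w : ι → ℝ) {K : ℕ} (c : ℝ) (j : ℕ) (N : Fin K → ℕ)
    (y : ℕ) :
    truncatedMixture m x w c (Fin.cons j N : Fin (K + 1) → ℕ) y =
      ∑ a, w a * (poissonWeight (m * x a) j * truncatedMixture m x w (c - x a) N y) := by
  unfold truncatedMixture
  rw [sum_fin_cons]
  refine Finset.sum_congr rfl fun a _ => ?_
  rw [Finset.mul_sum, Finset.mul_sum]
  refine Finset.sum_congr rfl fun u _ => ?_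
  simp only [Fin.prod_univ_succ, Fin.sum_univ_succ, Fin.cons_zero, Fin.cons_succ]
  have h : x a + ∑ i, x (u i) ≤ c ↔ ∑ i, x (u i) ≤ c - x a := by
    constructor <;> intro h <;> linarith
  simp only [h, sub_sub]
  split_ifs <;> ring

lemma sum_prod_weight_mul_exp (w x : ι → ℝ) (s : ℝ) (K : ℕ) :
    ∑ u : Fin K → ι, (∏ i, w (u i)) * Real.exp (s * ∑ i, x (u i)) =
      (∑ a, w a * Real.exp (s * x a)) ^ K := by
  rw [Fintype.sum_pow]
  refine Finset.sum_congr rfl fun u _ => ?_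
  rw [Finset.prod_mul_distrib, Finset.mul_sum, Real.exp_sum]

lemma sum_prod_weight {w : ι → ℝ} (hw1 : ∑ a, w a = 1) (K : ℕ) :
    ∑ u : Fin K → ι, ∏ i, w (u i) = 1 := by
  rw [← Fintype.sum_pow, hw1, one_pow]

/-- Swapping the prior of one coordinate while the remaining ones leave the mass `c`. If `c < M`
the truncation may interfere with the matching of moments; this is paid for by an exponential
factor. -/
lemma sum_abs_swap_le {w w' x : ι → ℝ} {m M ε s : ℝ} {L : ℕ} (hm : 0 ≤ m)
    (hM : 0 ≤ M) (hx : ∀ a, 0 ≤ x a) (hxM : ∀ a, x a ≤ M)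
    (hw : ∀ a, 0 ≤ w a) (hw' : ∀ a, 0 ≤ w' a) (hw1 : ∑ a, w a = 1) (hw1' : ∑ a, w' a = 1)
    (hmom : ∀ l ≤ L, ∑ a, (w a - w' a) * x a ^ l = 0)
    (hε : ∀ n, ∑ l ∈ Finset.range n,
      (if l ≤ L then 0 else (2 * (m * M)) ^ l / (l.factorial : ℝ)) ≤ ε)
    (hs : 0 ≤ s) (c : ℝ) (B : ℕ) :
    ∑ j : Fin B, ∑ y : Fin B, |∑ a, (w a - w' a) * (poissonWeight (m * x a) j *
      if x a ≤ c then poissonWeight (m * (c - x a)) y else 0)| ≤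
      ε + 2 * Real.exp (-(s * (c - M))) := by
  have hε0 : 0 ≤ ε := by simpa using hε 0
  rcases le_or_gt M c with hMc | hMc
  · have hpow : ∀ v : ι → ℝ, ∀ l, ∑ a, v a * (m * x a) ^ l = m ^ l * ∑ a, v a * x a ^ l := by
      intro v l
      rw [Finset.mul_sum]
      exact Finset.sum_congr rfl fun a _ => by rw [mul_pow]; ring
    have hbd : ∀ v : ι → ℝ, (∀ a, 0 ≤ v a) → ∑ a, v a = 1 → ∀ l,
        0 ≤ ∑ a, v a * x a ^ l ∧ ∑ a, v a * x a ^ l ≤ M ^ l := by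
      intro v hv hv1 l
      refine ⟨Finset.sum_nonneg fun a _ => mul_nonneg (hv a) (pow_nonneg (hx a) _), ?_⟩
      calc ∑ a, v a * x a ^ l ≤ ∑ a, v a * M ^ l :=
            Finset.sum_le_sum fun a _ =>
              mul_le_mul_of_nonneg_left (pow_le_pow_left₀ (hx a) (hxM a) l) (hv a)
        _ = M ^ l := by rw [← Finset.sum_mul, hv1, one_mul]
    have key := sum_abs_compensated_le (v := fun a => w a - w' a) (x := fun a => m * x a)
      (M := m * M) (ε := ε) (c := m * c) (L := L) (mul_nonneg hm hM)
      (fun l hl => by rw [hpow, hmom l hl, mul_zero])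
      (fun l => by
        rw [hpow, abs_mul, abs_of_nonneg (pow_nonneg hm l), mul_pow]
        refine mul_le_mul_of_nonneg_left ?_ (pow_nonneg hm l)
        simp_rw [sub_mul, Finset.sum_sub_distrib]
        have h1 := hbd w hw hw1 l
        have h2 := hbd w' hw' hw1' l
        rw [abs_le]; constructor <;> linarith)
      hε (mul_nonneg hm (hM.trans hMc)) B
    have hexp : 0 ≤ 2 * Real.exp (-(s * (c - M))) := by positivity
    refine le_trans (le_of_eq ?_) (key.trans (by linarith))
    rw [← Fin.sum_univ_eq_sum_range (fun i => ∑ y ∈ Finset.range B, |∑ a, (w a - w' a) *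
      (poissonWeight (m * x a) i * poissonWeight (m * c - m * x a) y)|) B]
    refine Finset.sum_congr rfl fun j _ => ?_
    rw [← Fin.sum_univ_eq_sum_range (fun y => |∑ a, (w a - w' a) *
      (poissonWeight (m * x a) j * poissonWeight (m * c - m * x a) y)|) B]
    refine Finset.sum_congr rfl fun y _ => ?_
    congr 1
    refine Finset.sum_congr rfl fun a _ => ?_
    rw [if_pos ((hxM a).trans hMc), mul_sub]
  · have h1 : 1 ≤ Real.exp (-(s * (c - M))) := by
      rw [Real.one_le_exp_iff]; nlinarith
    have hif : ∀ a y, 0 ≤ if x a ≤ c then poissonWeight (m * (c - x a)) y else 0 := by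
      intro a y
      split_ifs with h
      · exact poissonWeight_nonneg (mul_nonneg hm (sub_nonneg.2 h)) _
      · exact le_rfl
    have hif1 : ∀ a, ∑ y : Fin B, (if x a ≤ c then poissonWeight (m * (c - x a)) y else 0) ≤ 1 := by
      intro a
      split_ifs with h
      · exact sum_fin_poissonWeight_le_one (mul_nonneg hm (sub_nonneg.2 h)) B
      · simp
    have h2 : ∑ j : Fin B, ∑ y : Fin B, |∑ a, (w a - w' a) * (poissonWeight (m * x a) j *
        if x a ≤ c then poissonWeight (m * (c - x a)) y else 0)| ≤ 2 := by
      calc _ ≤ ∑ j : Fin B, ∑ y : Fin B, ∑ a, (w a + w' a) * (poissonWeight (m * x a) j *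
            if x a ≤ c then poissonWeight (m * (c - x a)) y else 0) := by
            refine Finset.sum_le_sum fun j _ => Finset.sum_le_sum fun y _ =>
              (Finset.abs_sum_le_sum_abs _ _).trans (Finset.sum_le_sum fun a _ => ?_)
            have hnn := mul_nonneg (poissonWeight_nonneg (mul_nonneg hm (hx a)) (j : ℕ)) (hif a y)
            rw [abs_mul, abs_of_nonneg hnn]
            refine mul_le_mul_of_nonneg_right ?_ hnn
            rw [abs_le]; constructor <;> linarith [hw a, hw' a]
        _ = ∑ a, (w a + w' a) * ∑ j : Fin B, poissonWeight (m * x a) j *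
              ∑ y : Fin B, (if x a ≤ c then poissonWeight (m * (c - x a)) y else 0) := by
            simp_rw [Finset.mul_sum]
            rw [Finset.sum_comm' (t' := Finset.univ) (s' := fun _ => Finset.univ) (by simp)]
            conv_lhs => enter [2, y]; rw [Finset.sum_comm]
            rw [Finset.sum_comm]
            refine Finset.sum_congr rfl fun a _ => Finset.sum_comm
        _ ≤ ∑ a, (w a + w' a) * 1 := by
            refine Finset.sum_le_sum fun a _ =>
              mul_le_mul_of_nonneg_left ?_ (add_nonneg (hw a) (hw' a))
            calc _ ≤ ∑ j : Fin B, poissonWeight (m * x a) j * 1 :=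
                  Finset.sum_le_sum fun j _ => mul_le_mul_of_nonneg_left (hif1 a)
                    (poissonWeight_nonneg (mul_nonneg hm (hx a)) _)
              _ ≤ 1 := by
                  simp_rw [mul_one]
                  exact sum_fin_poissonWeight_le_one (mul_nonneg hm (hx a)) B
        _ = 2 := by simp_rw [mul_one, Finset.sum_add_distrib, hw1, hw1']; norm_num
    linarith

/-- Two truncated mixtures whose priors share their first `L` moments are close in total variation.
The priors of the `K` coordinates are swapped one after the other. -/
lemma sum_abs_truncatedMixture_sub_le {w w' x : ι → ℝ} {m M ε s ψ : ℝ} {L : ℕ} (hm : 0 ≤ m)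
    (hM : 0 ≤ M) (hx : ∀ a, 0 ≤ x a) (hxM : ∀ a, x a ≤ M)
    (hw : ∀ a, 0 ≤ w a) (hw' : ∀ a, 0 ≤ w' a) (hw1 : ∑ a, w a = 1) (hw1' : ∑ a, w' a = 1)
    (hmom : ∀ l ≤ L, ∑ a, (w a - w' a) * x a ^ l = 0)
    (hε : ∀ n, ∑ l ∈ Finset.range n,
      (if l ≤ L then 0 else (2 * (m * M)) ^ l / (l.factorial : ℝ)) ≤ ε)
    (hs : 0 ≤ s) (hψ1 : 1 ≤ ψ) (hψ : ∑ a, w a * Real.exp (s * x a) ≤ ψ)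
    (hψ' : ∑ a, w' a * Real.exp (s * x a) ≤ ψ) (B K : ℕ) (c : ℝ) :
    ∑ N : Fin K → Fin B, ∑ y : Fin B, |truncatedMixture m x w c (fun i => (N i : ℕ)) y -
      truncatedMixture m x w' c (fun i => (N i : ℕ)) y| ≤
      K * (ε + 2 * (Real.exp (-(s * (c - M))) * ψ ^ K)) := by
  have hψ0 : 0 ≤ ψ := zero_le_one.trans hψ1
  induction K generalizing c with
  | zero => simp [truncatedMixture]
  | succ K ih =>
    set E := Real.exp (-(s * (c - M))) with hE
    have hE0 : 0 ≤ E := (Real.exp_pos _).le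
    have hcons : ∀ (j : Fin B) (N : Fin K → Fin B),
        (fun i => ((Fin.cons j N : Fin (K + 1) → Fin B) i : ℕ)) =
          (Fin.cons (j : ℕ) (fun i => (N i : ℕ)) : Fin (K + 1) → ℕ) := by
      intro j N
      funext i
      refine Fin.cases ?_ (fun i => ?_) i <;> simp
    rw [sum_fin_cons]
    simp_rw [hcons, truncatedMixture_cons]
    -- in the first sum the remaining coordinates change their prior, in the second one the first does
    have hsplit : ∀ (j : Fin B) (N : Fin K → Fin B) (y : Fin B),
        |∑ a, w a * (poissonWeight (m * x a) j *
            truncatedMixture m x w (c - x a) (fun i => (N i : ℕ)) y) -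
          ∑ a, w' a * (poissonWeight (m * x a) j *
            truncatedMixture m x w' (c - x a) (fun i => (N i : ℕ)) y)| ≤
        ∑ a, w a * (poissonWeight (m * x a) j *
          |truncatedMixture m x w (c - x a) (fun i => (N i : ℕ)) y -
            truncatedMixture m x w' (c - x a) (fun i => (N i : ℕ)) y|) +
        ∑ u : Fin K → ι, (∏ i, w' (u i)) * ((∏ i, poissonWeight (m * x (u i)) (N i)) *
          |∑ a, (w a - w' a) * (poissonWeight (m * x a) j * if x a ≤ c - ∑ i, x (u i) then
            poissonWeight (m * (c - ∑ i, x (u i) - x a)) y else 0)|) := by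
      intro j N y
      have hdec : ∑ a, w a * (poissonWeight (m * x a) j *
            truncatedMixture m x w (c - x a) (fun i => (N i : ℕ)) y) -
          ∑ a, w' a * (poissonWeight (m * x a) j *
            truncatedMixture m x w' (c - x a) (fun i => (N i : ℕ)) y) =
          ∑ a, w a * (poissonWeight (m * x a) j *
            (truncatedMixture m x w (c - x a) (fun i => (N i : ℕ)) y -
              truncatedMixture m x w' (c - x a) (fun i => (N i : ℕ)) y)) +
          ∑ a, (w a - w' a) * (poissonWeight (m * x a) j *
            truncatedMixture m x w' (c - x a) (fun i => (N i : ℕ)) y) := by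
        rw [← Finset.sum_sub_distrib, ← Finset.sum_add_distrib]
        exact Finset.sum_congr rfl fun a _ => by ring
      have hsw : ∑ a, (w a - w' a) * (poissonWeight (m * x a) j *
            truncatedMixture m x w' (c - x a) (fun i => (N i : ℕ)) y) =
          ∑ u : Fin K → ι, (∏ i, w' (u i)) * ((∏ i, poissonWeight (m * x (u i)) (N i)) *
          ∑ a, (w a - w' a) * (poissonWeight (m * x a) j * if x a ≤ c - ∑ i, x (u i) then
            poissonWeight (m * (c - ∑ i, x (u i) - x a)) y else 0)) := by
        unfold truncatedMixture
        simp_rw [Finset.mul_sum]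
        rw [Finset.sum_comm]
        refine Finset.sum_congr rfl fun u _ => Finset.sum_congr rfl fun a _ => ?_
        have h : ∑ i, x (u i) ≤ c - x a ↔ x a ≤ c - ∑ i, x (u i) := by
          constructor <;> intro h <;> linarith
        simp only [h, sub_right_comm c (x a)]
        split_ifs <;> ring
      rw [hdec, hsw]
      refine (abs_add_le _ _).trans (add_le_add ?_ ?_)
      · refine (Finset.abs_sum_le_sum_abs _ _).trans (le_of_eq ?_)
        refine Finset.sum_congr rfl fun a _ => ?_
        rw [abs_mul, abs_mul, abs_of_nonneg (hw a),
          abs_of_nonneg (poissonWeight_nonneg (mul_nonneg hm (hx a)) _)]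
      · refine (Finset.abs_sum_le_sum_abs _ _).trans (le_of_eq ?_)
        refine Finset.sum_congr rfl fun u _ => ?_
        rw [abs_mul, abs_mul, abs_of_nonneg (Finset.prod_nonneg fun i _ => hw' _),
          abs_of_nonneg (Finset.prod_nonneg fun i _ =>
            poissonWeight_nonneg (mul_nonneg hm (hx _)) _)]
    have hfirst : ∑ j : Fin B, ∑ N : Fin K → Fin B, ∑ y : Fin B,
        ∑ a, w a * (poissonWeight (m * x a) j *
          |truncatedMixture m x w (c - x a) (fun i => (N i : ℕ)) y -
            truncatedMixture m x w' (c - x a) (fun i => (N i : ℕ)) y|) ≤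
        K * (ε + 2 * (E * ψ ^ (K + 1))) := by
      calc _ = ∑ a, w a * ((∑ j : Fin B, poissonWeight (m * x a) j) *
            ∑ N : Fin K → Fin B, ∑ y : Fin B,
              |truncatedMixture m x w (c - x a) (fun i => (N i : ℕ)) y -
                truncatedMixture m x w' (c - x a) (fun i => (N i : ℕ)) y|) := by
            conv_lhs => enter [2, j, 2, N]; rw [Finset.sum_comm]
            conv_lhs => enter [2, j]; rw [Finset.sum_comm]
            rw [Finset.sum_comm]
            refine Finset.sum_congr rfl fun a _ => ?_
            simp_rw [Finset.sum_mul, Finset.mul_sum]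
        _ ≤ ∑ a, w a * (K * (ε + 2 * (Real.exp (-(s * (c - x a - M))) * ψ ^ K))) := by
            refine Finset.sum_le_sum fun a _ => mul_le_mul_of_nonneg_left ?_ (hw a)
            refine (mul_le_of_le_one_left ?_
              (sum_fin_poissonWeight_le_one (mul_nonneg hm (hx a)) B)).trans (ih (c - x a))
            exact Finset.sum_nonneg fun _ _ => Finset.sum_nonneg fun _ _ => abs_nonneg _
        _ = K * (ε * ∑ a, w a + 2 * (E * ψ ^ K) * ∑ a, w a * Real.exp (s * x a)) := by
            rw [Finset.mul_sum, Finset.mul_sum, ← Finset.sum_add_distrib, Finset.mul_sum]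
            refine Finset.sum_congr rfl fun a _ => ?_
            have : Real.exp (-(s * (c - x a - M))) = E * Real.exp (s * x a) := by
              rw [hE, ← Real.exp_add]; ring_nf
            rw [this]; ring
        _ ≤ K * (ε + 2 * (E * ψ ^ (K + 1))) := by
            rw [hw1, mul_one, pow_succ]
            have h0 : 0 ≤ 2 * (E * ψ ^ K) := by positivity
            have := mul_le_mul_of_nonneg_left hψ h0
            refine mul_le_mul_of_nonneg_left ?_ (Nat.cast_nonneg K)
            linarith
    have hsecond : ∑ j : Fin B, ∑ N : Fin K → Fin B, ∑ y : Fin B,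
        ∑ u : Fin K → ι, (∏ i, w' (u i)) * ((∏ i, poissonWeight (m * x (u i)) (N i)) *
          |∑ a, (w a - w' a) * (poissonWeight (m * x a) j * if x a ≤ c - ∑ i, x (u i) then
            poissonWeight (m * (c - ∑ i, x (u i) - x a)) y else 0)|) ≤
        ε + 2 * (E * ψ ^ (K + 1)) := by
      have hW0 : ∀ u : Fin K → ι, 0 ≤ ∏ i, w' (u i) := fun u => Finset.prod_nonneg fun i _ => hw' _
      calc _ = ∑ u : Fin K → ι, (∏ i, w' (u i)) *
            ((∑ N : Fin K → Fin B, ∏ i, poissonWeight (m * x (u i)) (N i)) *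
            ∑ j : Fin B, ∑ y : Fin B,
              |∑ a, (w a - w' a) * (poissonWeight (m * x a) j * if x a ≤ c - ∑ i, x (u i) then
                poissonWeight (m * (c - ∑ i, x (u i) - x a)) y else 0)|) := by
            conv_lhs => enter [2, j, 2, N]; rw [Finset.sum_comm]
            conv_lhs => enter [2, j]; rw [Finset.sum_comm]
            rw [Finset.sum_comm]
            refine Finset.sum_congr rfl fun u _ => ?_
            rw [Finset.sum_comm]
            simp_rw [Finset.sum_mul, Finset.mul_sum]
        _ ≤ ∑ u : Fin K → ι, (∏ i, w' (u i)) *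
              (ε + 2 * Real.exp (-(s * (c - ∑ i, x (u i) - M)))) := by
            refine Finset.sum_le_sum fun u _ => mul_le_mul_of_nonneg_left ?_ (hW0 u)
            refine (mul_le_of_le_one_left ?_ (sum_prod_poissonWeight_le_one
              (fun i => mul_nonneg hm (hx _)) B)).trans
              (sum_abs_swap_le hm hM hx hxM hw hw' hw1 hw1' hmom hε hs _ B)
            exact Finset.sum_nonneg fun _ _ => Finset.sum_nonneg fun _ _ => abs_nonneg _
        _ = ε * ∑ u : Fin K → ι, ∏ i, w' (u i) +
              2 * E * ∑ u : Fin K → ι, (∏ i, w' (u i)) * Real.exp (s * ∑ i, x (u i)) := by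
            rw [Finset.mul_sum, Finset.mul_sum, ← Finset.sum_add_distrib]
            refine Finset.sum_congr rfl fun u _ => ?_
            have : Real.exp (-(s * (c - ∑ i, x (u i) - M))) =
                E * Real.exp (s * ∑ i, x (u i)) := by
              rw [hE, ← Real.exp_add]; ring_nf
            rw [this]; ring
        _ ≤ ε + 2 * (E * ψ ^ (K + 1)) := by
            rw [sum_prod_weight hw1', sum_prod_weight_mul_exp, mul_one]
            have h1 : (∑ a, w' a * Real.exp (s * x a)) ^ K ≤ ψ ^ (K + 1) :=
              (pow_le_pow_left₀ (Finset.sum_nonneg fun a _ =>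
                mul_nonneg (hw' a) (Real.exp_pos _).le) hψ' K).trans
                (pow_le_pow_right₀ hψ1 (Nat.le_succ K))
            have := mul_le_mul_of_nonneg_left h1 (by positivity : 0 ≤ 2 * E)
            linarith
    calc _ ≤ _ := Finset.sum_le_sum fun j _ => Finset.sum_le_sum fun N _ =>
          Finset.sum_le_sum fun y _ => hsplit j N y
      _ ≤ K * (ε + 2 * (E * ψ ^ (K + 1))) + (ε + 2 * (E * ψ ^ (K + 1))) := by
          simp_rw [Finset.sum_add_distrib] at hfirst hsecond ⊢
          exact add_le_add hfirst hsecond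
      _ = _ := by push_cast; ring

/-! ### Duality for best polynomial approximation -/

/-- If every finitely supported signed measure on `I` that annihilates the polynomials of degree at
most `L` integrates `f` to at most `e` times its total mass, then `f` is uniformly within `e` of
such a polynomial. The functional `f` on the annihilator extends to all finitely supported measures
with the same norm, that is, to a function bounded by `e`; the extension differs from `f` by an
element of the double annihilator, a polynomial. -/
lemma exists_polynomial_near_of_annihilator_bound (I : Set ℝ) (f : ℝ → ℝ) (L : ℕ) {e : ℝ}
    (he : 0 ≤ e)
    (h : ∀ v : I →₀ ℝ, (∀ l ≤ L, v.sum (fun x r => r * (x : ℝ) ^ l) = 0) →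
      v.sum (fun x r => r * f x) ≤ e * v.sum fun _ r => |r|) :
    ∃ g : Polynomial ℝ, g.natDegree ≤ L ∧ ∀ x ∈ I, |f x - g.eval x| ≤ e := by
  classical
  let mon : Fin (L + 1) → (I →₀ ℝ) →ₗ[ℝ] ℝ := fun l =>
    Finsupp.linearCombination ℝ fun x : I => (x : ℝ) ^ (l : ℕ)
  let F : (I →₀ ℝ) →ₗ[ℝ] ℝ := Finsupp.linearCombination ℝ fun x : I => f x
  let N : (I →₀ ℝ) → ℝ := fun v => e * v.sum fun _ r => |r|
  have hN : ∀ v : I →₀ ℝ, ∀ S : Finset I, v.support ⊆ S → N v = e * ∑ x ∈ S, |v x| := by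
    intro v S hS
    simp only [N]
    rw [Finsupp.sum_of_support_subset v hS _ (by simp)]
  obtain ⟨G, hG, hGN⟩ := exists_extension_of_le_sublinear
    ⟨⨅ l, (mon l).ker, F.comp (⨅ l, (mon l).ker).subtype⟩ N
    (by
      intro c hc v
      rw [hN (c • v) v.support Finsupp.support_smul, hN v v.support subset_rfl]
      simp only [Finsupp.smul_apply, smul_eq_mul, abs_mul, abs_of_pos hc, ← Finset.mul_sum]
      ring)
    (by
      intro v v'
      rw [hN (v + v') (v.support ∪ v'.support) Finsupp.support_add,
        hN v (v.support ∪ v'.support) Finset.subset_union_left,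
        hN v' (v.support ∪ v'.support) Finset.subset_union_right, ← mul_add,
        ← Finset.sum_add_distrib]
      refine mul_le_mul_of_nonneg_left (Finset.sum_le_sum fun x _ => ?_) he
      exact abs_add_le _ _)
    (by
      rintro ⟨v, hv⟩
      refine le_trans (le_of_eq ?_) (h v fun l hl => ?_)
      · simp [F, Finsupp.linearCombination_apply]
      · have := (Submodule.mem_iInf _).1 hv ⟨l, Nat.lt_succ_of_le hl⟩
        simpa [mon, Finsupp.linearCombination_apply] using this)
  have hker : ⨅ l, (mon l).ker ≤ (F - G).ker := by
    intro v hv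
    have := hG ⟨v, hv⟩
    rw [LinearMap.mem_ker, LinearMap.sub_apply, sub_eq_zero]
    exact this.symm
  obtain ⟨b, hb⟩ := (Submodule.mem_span_range_iff_exists_fun ℝ).1 (mem_span_of_iInf_ker_le_ker hker)
  refine ⟨∑ l : Fin (L + 1), Polynomial.C (b l) * Polynomial.X ^ (l : ℕ), ?_, fun x hx => ?_⟩
  · refine Polynomial.natDegree_sum_le_of_forall_le _ _ fun l _ => ?_
    exact (Polynomial.natDegree_C_mul_X_pow_le _ _).trans (Nat.lt_succ_iff.1 l.2)
  · have h1 := congrArg (fun T : (I →₀ ℝ) →ₗ[ℝ] ℝ => T (Finsupp.single ⟨x, hx⟩ 1)) hb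
    have h2 : ∑ l, b l * x ^ (l : ℕ) = f x - G (Finsupp.single ⟨x, hx⟩ 1) := by
      simpa [mon, F, Finsupp.linearCombination_single] using h1
    have h3 : (∑ l : Fin (L + 1), Polynomial.C (b l) * Polynomial.X ^ (l : ℕ)).eval x =
        ∑ l, b l * x ^ (l : ℕ) := by
      simp [Polynomial.eval_finsetSum]
    rw [h3, h2, sub_sub_cancel, abs_le]
    have hs : ∀ r : ℝ, |r| = 1 → G (Finsupp.single ⟨x, hx⟩ r) ≤ e := by
      intro r hr
      have := hGN (Finsupp.single ⟨x, hx⟩ r)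
      simpa [N, Finsupp.sum_single_index, hr] using this
    have hneg : G (Finsupp.single ⟨x, hx⟩ (-1)) = -G (Finsupp.single ⟨x, hx⟩ 1) := by
      rw [← map_neg, Finsupp.single_neg]
    have h4 := hs 1 (by simp)
    have h5 := hs (-1) (by simp)
    constructor <;> linarith

lemma bestApproxError_le_of_polynomial {L : ℕ} {f : ℝ → ℝ} {I : Set ℝ} {e : ℝ} (he : 0 ≤ e)
    (g : Polynomial ℝ) (hg : g.natDegree ≤ L) (h : ∀ x ∈ I, |f x - g.eval x| ≤ e) :
    bestApproxError L f I ≤ e := by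
  unfold bestApproxError
  refine ENNReal.toReal_le_of_le_ofReal he ?_
  refine (iInf_le _ ⟨g, hg⟩).trans ?_
  exact iSup₂_le fun x hx => ENNReal.ofReal_le_ofReal (h x hx)

/-- Two probability vectors on a finite set of points of `I` with the same moments up to the order
`L` whose integrals of `f` differ by more than `2 * e`, for any `e` below the best approximation
error. -/
lemma exists_moment_matching_weights (I : Set ℝ) (f : ℝ → ℝ) (L : ℕ) {e : ℝ}
    (he : 0 ≤ e) (heE : e < bestApproxError L f I) :
    ∃ (S : Finset ℝ) (ν ν' : S → ℝ), (∀ a : S, (a : ℝ) ∈ I) ∧ (∀ a, 0 ≤ ν a) ∧ (∀ a, 0 ≤ ν' a) ∧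
      ∑ a, ν a = 1 ∧ ∑ a, ν' a = 1 ∧
      (∀ l ≤ L, ∑ a, (ν a - ν' a) * (a : ℝ) ^ l = 0) ∧
      2 * e ≤ ∑ a, (ν a - ν' a) * f a := by
  classical
  have hex : ∃ v : I →₀ ℝ, (∀ l ≤ L, v.sum (fun x r => r * (x : ℝ) ^ l) = 0) ∧
      e * (v.sum fun _ r => |r|) < v.sum (fun x r => r * f x) := by
    by_contra! hcon
    obtain ⟨g, hg, hfg⟩ := exists_polynomial_near_of_annihilator_bound I f L he hcon
    exact absurd (bestApproxError_le_of_polynomial he g hg hfg) (not_le.2 heE)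
  obtain ⟨v, hmom, hgap⟩ := hex
  let S : Finset ℝ := v.support.map (Function.Embedding.subtype _)
  have hSI : ∀ a : S, (a : ℝ) ∈ I := by
    rintro ⟨a, ha⟩
    simp only [S, Finset.mem_map] at ha
    obtain ⟨b, _, rfl⟩ := ha
    exact b.2
  let r : S → ℝ := fun a => v ⟨a, hSI a⟩
  have hsum : ∀ F : ℝ → ℝ → ℝ, v.sum (fun x t => F x t) = ∑ a : S, F a (r a) := by
    intro F
    let F' : ℝ → ℝ := fun a => if h : a ∈ I then F a (v ⟨a, h⟩) else 0
    have h1 : ∑ a : S, F a (r a) = ∑ a : S, F' a :=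
      Finset.sum_congr rfl fun a _ => by simp only [F', r]; rw [dif_pos (hSI a)]
    rw [h1, Finset.sum_coe_sort S F', Finset.sum_map]
    refine Finset.sum_congr rfl fun b _ => ?_
    simp [F']
  rw [hsum fun x t => t * f x, hsum fun _ t => |t|] at hgap
  have hmom' : ∀ l ≤ L, ∑ a, r a * (a : ℝ) ^ l = 0 := by
    intro l hl
    rw [← hmom l hl, hsum fun x t => t * x ^ l]
  set T := ∑ a, |r a| with hT
  have hTpos : 0 < T := by
    rcases (Finset.sum_nonneg fun a (_ : a ∈ Finset.univ) => abs_nonneg (r a)).lt_or_eq with h | h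
    · exact h
    · exfalso
      have h0 : ∀ a, r a = 0 := fun a => by
        simpa using (Finset.sum_eq_zero_iff_of_nonneg fun a _ => abs_nonneg (r a)).1 h.symm a
          (Finset.mem_univ a)
      simp [hT, h0] at hgap
  -- the positive and the negative part have the same mass `T / 2`
  have hr0 : ∑ a, r a = 0 := by simpa using hmom' 0 (Nat.zero_le _)
  have hdiff : ∀ a, (|r a| + r a) / T - (|r a| - r a) / T = 2 / T * r a := fun a => by ring
  refine ⟨S, fun a => (|r a| + r a) / T, fun a => (|r a| - r a) / T, hSI,
    fun a => div_nonneg (by linarith [neg_abs_le (r a)]) hTpos.le,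
    fun a => div_nonneg (by linarith [le_abs_self (r a)]) hTpos.le, ?_, ?_, ?_, ?_⟩
  · rw [← Finset.sum_div, Finset.sum_add_distrib, hr0, add_zero, div_self hTpos.ne']
  · rw [← Finset.sum_div, Finset.sum_sub_distrib, hr0, sub_zero, div_self hTpos.ne']
  · intro l hl
    simp_rw [hdiff, mul_assoc]
    rw [← Finset.mul_sum, hmom' l hl, mul_zero]
  · simp_rw [hdiff, mul_assoc]
    rw [← Finset.mul_sum, div_mul_eq_mul_div, le_div_iff₀ hTpos]
    linarith

/-- The reweighting `(c / x) ν(dx)`, completed by an atom at `0`, turns weights matched for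
`φ x / x` into priors of mean `c` matched for `φ`. -/
lemma exists_matching_priors {φ : ℝ → ℝ} (hφ0 : φ 0 = 0) {γ M c : ℝ} (hγ : 0 < γ) (hM : 0 ≤ M) (L : ℕ)
    (hc : 0 ≤ c) (hcγ : c ≤ γ) {e : ℝ} (he : 0 ≤ e)
    (heE : e < bestApproxError L (fun p => φ p / p) (Icc γ M)) :
    ∃ (ι : Type) (_ : Fintype ι) (x w w' : ι → ℝ), (∀ a, 0 ≤ x a) ∧ (∀ a, x a ≤ M) ∧
      (∀ a, 0 ≤ w a) ∧ (∀ a, 0 ≤ w' a) ∧ ∑ a, w a = 1 ∧ ∑ a, w' a = 1 ∧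
      ∑ a, w a * x a = c ∧ ∑ a, w' a * x a = c ∧
      (∀ l ≤ L, ∑ a, (w a - w' a) * x a ^ l = 0) ∧
      c * (2 * e) ≤ ∑ a, (w a - w' a) * φ (x a) := by
  obtain ⟨S, ν, ν', hSI, hν, hν', hν1, hν1', hmom, hgap⟩ :=
    exists_moment_matching_weights (Icc γ M) (fun p => φ p / p) L he heE
  have hpos : ∀ a : S, 0 < (a : ℝ) := fun a => hγ.trans_le (hSI a).1
  have hle : ∀ ν : S → ℝ, (∀ a, 0 ≤ ν a) → ∑ a, ν a = 1 → ∑ a : S, c / (a : ℝ) * ν a ≤ 1 := by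
    intro ν hν hν1
    rw [← hν1]
    refine Finset.sum_le_sum fun a _ => mul_le_of_le_one_left (hν a) ?_
    exact (div_le_one (hpos a)).2 (hcγ.trans (hSI a).1)
  have hnn : ∀ ν : S → ℝ, (∀ a, 0 ≤ ν a) → ∀ a : S, 0 ≤ c / (a : ℝ) * ν a := fun ν hν a =>
    mul_nonneg (div_nonneg hc (hpos a).le) (hν a)
  let W : (S → ℝ) → Option S → ℝ := fun ν a =>
    a.elim (1 - ∑ b : S, c / (b : ℝ) * ν b) fun b => c / (b : ℝ) * ν b
  have hmean : ∀ ν : S → ℝ, ∑ a, ν a = 1 → ∑ a : S, c / (a : ℝ) * ν a * a = c := by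
    intro ν hν1
    calc ∑ a : S, c / (a : ℝ) * ν a * a = ∑ a, c * ν a :=
          Finset.sum_congr rfl fun a _ => by
            have := (hpos a).ne'
            field_simp
      _ = c := by rw [← Finset.mul_sum, hν1, mul_one]
  refine ⟨Option S, inferInstance, fun a => a.elim 0 fun b => (b : ℝ), W ν, W ν', ?_, ?_, ?_, ?_,
    ?_, ?_, ?_, ?_, ?_, ?_⟩
  · rintro (_ | a)
    · exact le_rfl
    · exact (hpos a).le
  · rintro (_ | a)
    · exact hM
    · exact (hSI a).2
  · rintro (_ | a)
    · exact sub_nonneg.2 (hle ν hν hν1)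
    · exact hnn ν hν a
  · rintro (_ | a)
    · exact sub_nonneg.2 (hle ν' hν' hν1')
    · exact hnn ν' hν' a
  · simp [W, Fintype.sum_option]
  · simp [W, Fintype.sum_option]
  · simpa [W, Fintype.sum_option] using hmean ν hν1
  · simpa [W, Fintype.sum_option] using hmean ν' hν1'
  · intro l hl
    cases l with
    | zero => simp [W, Fintype.sum_option]
    | succ l =>
      have h0 := hmom l (by omega)
      simp only [W, Fintype.sum_option, Option.elim_none, Option.elim_some]
      rw [zero_pow (Nat.succ_ne_zero l), mul_zero, zero_add, ← mul_zero c, ← h0, Finset.mul_sum]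
      refine Finset.sum_congr rfl fun a _ => ?_
      have := (hpos a).ne'
      rw [pow_succ]
      field_simp
  · simp only [W, Fintype.sum_option, Option.elim_none, Option.elim_some, hφ0, mul_zero, zero_add]
    refine (mul_le_mul_of_nonneg_left hgap hc).trans (le_of_eq ?_)
    rw [Finset.mul_sum]
    refine Finset.sum_congr rfl fun a _ => ?_
    have := (hpos a).ne'
    field_simp

/-! ### Variance of a sum of independent draws -/

lemma sum_prod_weight_mul_sum_of_centered {w h : ι → ℝ} (hw1 : ∑ a, w a = 1)
    (hh : ∑ a, w a * h a = 0) (K : ℕ) :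
    ∑ u : Fin K → ι, (∏ i, w (u i)) * ∑ i, h (u i) = 0 := by
  induction K with
  | zero => simp
  | succ K ih =>
    rw [sum_fin_cons]
    simp only [Fin.prod_univ_succ, Fin.sum_univ_succ, Fin.cons_zero, Fin.cons_succ]
    calc _ = ∑ a, (w a * h a * ∑ u : Fin K → ι, ∏ i, w (u i) +
          w a * ∑ u : Fin K → ι, (∏ i, w (u i)) * ∑ i, h (u i)) := by
          refine Finset.sum_congr rfl fun a _ => ?_
          rw [Finset.mul_sum, Finset.mul_sum, ← Finset.sum_add_distrib]
          exact Finset.sum_congr rfl fun u _ => by ring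
      _ = 0 := by simp [ih, sum_prod_weight hw1, hh]

lemma sum_prod_weight_mul_sum_sq_of_centered {w h : ι → ℝ} (hw1 : ∑ a, w a = 1)
    (hh : ∑ a, w a * h a = 0) (K : ℕ) :
    ∑ u : Fin K → ι, (∏ i, w (u i)) * (∑ i, h (u i)) ^ 2 = K * ∑ a, w a * h a ^ 2 := by
  induction K with
  | zero => simp
  | succ K ih =>
    rw [sum_fin_cons]
    simp only [Fin.prod_univ_succ, Fin.sum_univ_succ, Fin.cons_zero, Fin.cons_succ]
    calc _ = ∑ a, (w a * h a ^ 2 * ∑ u : Fin K → ι, ∏ i, w (u i) +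
          2 * (w a * h a) * ∑ u : Fin K → ι, (∏ i, w (u i)) * ∑ i, h (u i) +
          w a * ∑ u : Fin K → ι, (∏ i, w (u i)) * (∑ i, h (u i)) ^ 2) := by
          refine Finset.sum_congr rfl fun a _ => ?_
          rw [Finset.mul_sum, Finset.mul_sum, Finset.mul_sum, ← Finset.sum_add_distrib,
            ← Finset.sum_add_distrib]
          exact Finset.sum_congr rfl fun u _ => by ring
      _ = _ := by
          rw [ih, sum_prod_weight hw1, sum_prod_weight_mul_sum_of_centered hw1 hh]
          simp only [mul_one, mul_zero, add_zero]
          rw [Finset.sum_add_distrib, ← Finset.sum_mul, hw1]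
          push_cast; ring

lemma sum_prod_weight_mul_sub_mean_sq_le {w h : ι → ℝ} (hw1 : ∑ a, w a = 1) (K : ℕ) :
    ∑ u : Fin K → ι, (∏ i, w (u i)) * (∑ i, h (u i) - K * ∑ a, w a * h a) ^ 2 ≤
      K * ∑ a, w a * h a ^ 2 := by
  set μ := ∑ a, w a * h a with hμ
  have hc : ∑ a, w a * (h a - μ) = 0 := by
    simp_rw [mul_sub, Finset.sum_sub_distrib, ← Finset.sum_mul, hw1]
    rw [one_mul, hμ, sub_self]
  have h1 := sum_prod_weight_mul_sum_sq_of_centered hw1 hc K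
  have h2 : ∀ u : Fin K → ι, ∑ i, (h (u i) - μ) = ∑ i, h (u i) - K * μ := by
    intro u; simp [Finset.sum_sub_distrib]
  simp_rw [h2] at h1
  rw [h1]
  refine mul_le_mul_of_nonneg_left ?_ (Nat.cast_nonneg K)
  have h3 : ∑ a, w a * (h a - μ) ^ 2 = ∑ a, w a * h a ^ 2 - μ ^ 2 := by
    have : ∀ a, w a * (h a - μ) ^ 2 = w a * h a ^ 2 - 2 * μ * (w a * h a) + μ ^ 2 * w a :=
      fun a => by ring
    simp_rw [this, Finset.sum_add_distrib, Finset.sum_sub_distrib, ← Finset.mul_sum, hw1, ← hμ]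
    ring
  rw [h3]
  linarith [sq_nonneg μ]

/-! ### Bayes risk under the truncated priors -/

lemma hasSum_poissonWeight (a : ℝ) : HasSum (poissonWeight a) 1 := by
  have h := (NormedSpace.expSeries_div_hasSum_exp (a : ℝ)).mul_left (Real.exp (-a))
  rw [← Real.exp_eq_exp_ℝ, ← Real.exp_add, neg_add_cancel, Real.exp_zero] at h
  exact h

lemma tendsto_sum_fin_poissonWeight (a : ℝ) :
    Filter.Tendsto (fun B : ℕ => ∑ j : Fin B, poissonWeight a j) Filter.atTop (nhds 1) := by
  simp_rw [fun B => Fin.sum_univ_eq_sum_range (poissonWeight a) B]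
  exact (hasSum_poissonWeight a).tendsto_sum_nat

/-- Expanding a sum against a truncated mixture over the draws of the prior. -/
lemma sum_truncatedMixture_mul (m : ℝ) (x w : ι → ℝ) {K : ℕ} (c : ℝ) (B : ℕ)
    (F : (Fin K → Fin B) → Fin B → ℝ) :
    ∑ N : Fin K → Fin B, ∑ y : Fin B, truncatedMixture m x w c (fun i => (N i : ℕ)) y * F N y =
      ∑ u : Fin K → ι, (∏ i, w (u i)) * if ∑ i, x (u i) ≤ c then
        ∑ N : Fin K → Fin B, ∑ y : Fin B, (∏ i, poissonWeight (m * x (u i)) (N i)) *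
          poissonWeight (m * (c - ∑ i, x (u i))) y * F N y else 0 := by
  unfold truncatedMixture
  simp_rw [Finset.sum_mul]
  conv_lhs => enter [2, N]; rw [Finset.sum_comm]
  rw [Finset.sum_comm]
  refine Finset.sum_congr rfl fun u _ => ?_
  split_ifs
  · simp_rw [Finset.mul_sum, mul_assoc]
  · simp

lemma tendsto_sum_truncatedMixture (m : ℝ) (x w : ι → ℝ) (K : ℕ) (c : ℝ) :
    Filter.Tendsto (fun B : ℕ => ∑ N : Fin K → Fin B, ∑ y : Fin B,
        truncatedMixture m x w c (fun i => (N i : ℕ)) y) Filter.atTop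
      (nhds (∑ u : Fin K → ι, (∏ i, w (u i)) * if ∑ i, x (u i) ≤ c then 1 else 0)) := by
  have h : ∀ B : ℕ, ∑ N : Fin K → Fin B, ∑ y : Fin B,
      truncatedMixture m x w c (fun i => (N i : ℕ)) y =
      ∑ u : Fin K → ι, (∏ i, w (u i)) * if ∑ i, x (u i) ≤ c then
        (∏ i, ∑ j : Fin B, poissonWeight (m * x (u i)) j) *
          ∑ y : Fin B, poissonWeight (m * (c - ∑ i, x (u i))) y else 0 := by
    intro B
    have := sum_truncatedMixture_mul m x w c B fun (_ : Fin K → Fin B) _ => 1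
    simp only [mul_one] at this
    rw [this]
    refine Finset.sum_congr rfl fun u _ => ?_
    have h := Finset.prod_univ_sum (fun _ : Fin K => (Finset.univ : Finset (Fin B)))
      (fun i j => poissonWeight (m * x (u i)) j)
    rw [Fintype.piFinset_univ] at h
    rw [h, Finset.sum_mul]
    simp_rw [Finset.mul_sum]
  simp_rw [h]
  refine tendsto_finsetSum _ fun u _ => Filter.Tendsto.const_mul _ ?_
  split_ifs
  · have h1 := tendsto_finsetProd (Finset.univ : Finset (Fin K))
      fun i _ => tendsto_sum_fin_poissonWeight (m * x (u i))
    simpa using h1.mul (tendsto_sum_fin_poissonWeight (m * (c - ∑ i, x (u i))))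
  · exact tendsto_const_nhds

lemma one_sub_le_sum_prod_weight_indicator {w x : ι → ℝ} (hw : ∀ a, 0 ≤ w a)
    (hw1 : ∑ a, w a = 1) {s : ℝ} (hs : 0 ≤ s) {ψ : ℝ}
    (hψ : ∑ a, w a * Real.exp (s * x a) ≤ ψ) (K : ℕ) (c : ℝ) :
    1 - Real.exp (-(s * c)) * ψ ^ K ≤
      ∑ u : Fin K → ι, (∏ i, w (u i)) * if ∑ i, x (u i) ≤ c then 1 else 0 := by
  have h0 : ∀ u : Fin K → ι, 0 ≤ ∏ i, w (u i) := fun u => Finset.prod_nonneg fun i _ => hw _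
  have h1 : (∑ a, w a * Real.exp (s * x a)) ^ K ≤ ψ ^ K :=
    pow_le_pow_left₀ (Finset.sum_nonneg fun a _ => mul_nonneg (hw a) (Real.exp_pos _).le) hψ K
  have h2 : ∑ u : Fin K → ι, ((∏ i, w (u i)) - Real.exp (-(s * c)) *
      ((∏ i, w (u i)) * Real.exp (s * ∑ i, x (u i)))) ≤
      ∑ u : Fin K → ι, (∏ i, w (u i)) * if ∑ i, x (u i) ≤ c then 1 else 0 := by
    refine Finset.sum_le_sum fun u _ => ?_
    have hE : 0 ≤ Real.exp (-(s * c)) * Real.exp (s * ∑ i, x (u i)) := by positivity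
    split_ifs with h
    · nlinarith [mul_nonneg (h0 u) hE]
    · have : 1 ≤ Real.exp (-(s * c)) * Real.exp (s * ∑ i, x (u i)) := by
        rw [← Real.exp_add, Real.one_le_exp_iff]
        have := mul_le_mul_of_nonneg_left (not_le.1 h).le hs
        linarith
      nlinarith [mul_le_mul_of_nonneg_left this (h0 u)]
  rw [Finset.sum_sub_distrib, ← Finset.mul_sum, sum_prod_weight hw1, sum_prod_weight_mul_exp] at h2
  have := mul_le_mul_of_nonneg_left h1 (Real.exp_pos (-(s * c))).le
  linarith

/-- The quadratic loss around the prior mean of the functional, averaged over the truncated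
mixture, is bounded by the worst-case risk `R` plus the prior variance of the functional. -/
lemma sum_truncatedMixture_sq_le {φ : ℝ → ℝ} {x w : ι → ℝ} {m A c v₁ v₂ R : ℝ} {K : ℕ}
    (hm : 0 ≤ m) (hx : ∀ a, 0 ≤ x a) (hw : ∀ a, 0 ≤ w a) (hw1 : ∑ a, w a = 1)
    (hmean : ∑ a, w a * x a = c) (hKc : K * c ≤ 1)
    (hLip : ∀ p ∈ Icc (0 : ℝ) 1, ∀ q ∈ Icc (0 : ℝ) 1, |φ p - φ q| ≤ A * |p - q|)
    (hv₁ : ∑ a, w a * φ (x a) ^ 2 ≤ v₁) (hv₂ : ∑ a, w a * x a ^ 2 ≤ v₂) (hR : 0 ≤ R)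
    (est : (Fin (K + 1) → ℕ) → ℝ) (B : ℕ)
    (hest : ∀ P ∈ stdSimplex ℝ (Fin (K + 1)), ∑ N : Fin K → Fin B, ∑ y : Fin B,
      (∏ i, poissonWeight (m * P i.succ) (N i)) * poissonWeight (m * P 0) y *
        (est (Fin.cons (y : ℕ) fun i => (N i : ℕ)) - theta φ P) ^ 2 ≤ R) :
    5 / 8 * ∑ N : Fin K → Fin B, ∑ y : Fin B, truncatedMixture m x w 1 (fun i => (N i : ℕ)) y *
      (est (Fin.cons (y : ℕ) fun i => (N i : ℕ)) -
        (K * ∑ a, w a * φ (x a) + φ (1 - K * c))) ^ 2 ≤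
      R + K * (15 / 8 * v₁ + 15 * A ^ 2 * v₂) := by
  set μ := ∑ a, w a * φ (x a) with hμ
  have hc0 : 0 ≤ c := hmean ▸ Finset.sum_nonneg fun a _ => mul_nonneg (hw a) (hx a)
  have h0 : ∀ u : Fin K → ι, 0 ≤ ∏ i, w (u i) := fun u => Finset.prod_nonneg fun i _ => hw _
  rw [sum_truncatedMixture_mul m x w 1 B fun N y =>
    (est (Fin.cons (y : ℕ) fun i => (N i : ℕ)) - (K * μ + φ (1 - K * c))) ^ 2, Finset.mul_sum]
  have hu : ∀ u : Fin K → ι, 5 / 8 * ((∏ i, w (u i)) * if ∑ i, x (u i) ≤ 1 then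
        ∑ N : Fin K → Fin B, ∑ y : Fin B, (∏ i, poissonWeight (m * x (u i)) (N i)) *
          poissonWeight (m * (1 - ∑ i, x (u i))) y *
          (est (Fin.cons (y : ℕ) fun i => (N i : ℕ)) - (K * μ + φ (1 - K * c))) ^ 2 else 0) ≤
      (∏ i, w (u i)) * (R + (15 / 8 * (∑ i, φ (x (u i)) - K * μ) ^ 2 +
        15 * A ^ 2 * (∑ i, x (u i) - K * c) ^ 2)) := by
    intro u
    rw [mul_left_comm]
    refine mul_le_mul_of_nonneg_left ?_ (h0 u)
    split_ifs with hG
    swap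
    · rw [mul_zero]; positivity
    set X := ∑ i, x (u i) with hX
    have hX0 : 0 ≤ X := Finset.sum_nonneg fun i _ => hx _
    set P : Fin (K + 1) → ℝ := Fin.cons (1 - X) fun i => x (u i) with hP
    have hPmem : P ∈ stdSimplex ℝ (Fin (K + 1)) := by
      refine ⟨fun i => ?_, ?_⟩
      · refine Fin.cases ?_ (fun i => ?_) i
        · simpa [hP] using hG
        · simpa [hP] using hx (u i)
      · simp [hP, Fin.sum_univ_succ, ← hX]
    have hθ : theta φ P = φ (1 - X) + ∑ i, φ (x (u i)) := by
      simp [theta, hP, Fin.sum_univ_succ]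
    have hR' := hest P hPmem
    simp only [hP, Fin.cons_succ, Fin.cons_zero] at hR'
    rw [← hP] at hR'
    set θ := theta φ P
    set f : (Fin K → Fin B) → Fin B → ℝ := fun N y =>
      (∏ i, poissonWeight (m * x (u i)) (N i)) * poissonWeight (m * (1 - X)) y with hf
    have hf0 : ∀ N y, 0 ≤ f N y := fun N y =>
      mul_nonneg (Finset.prod_nonneg fun i _ => poissonWeight_nonneg (mul_nonneg hm (hx _)) _)
        (poissonWeight_nonneg (mul_nonneg hm (sub_nonneg.2 hG)) _)
    have hf1 : ∑ N, ∑ y, f N y ≤ 1 := by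
      simp only [hf, ← Finset.mul_sum]
      rw [← Finset.sum_mul]
      exact mul_le_one₀ (sum_prod_poissonWeight_le_one (fun i => mul_nonneg hm (hx _)) B)
        (Finset.sum_nonneg fun y _ => poissonWeight_nonneg (mul_nonneg hm (sub_nonneg.2 hG)) _)
        (sum_fin_poissonWeight_le_one (mul_nonneg hm (sub_nonneg.2 hG)) B)
    set D := (θ - (K * μ + φ (1 - K * c))) ^ 2 with hD
    -- `(a + b) ^ 2 ≤ 9 / 8 * a ^ 2 + 9 * b ^ 2`, cheap for the variance of `∑ φ`
    have hDle : 5 / 3 * D ≤ 15 / 8 * (∑ i, φ (x (u i)) - K * μ) ^ 2 +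
        15 * A ^ 2 * (X - K * c) ^ 2 := by
      have hl := hLip (1 - X) ⟨by linarith, by linarith⟩ (1 - K * c)
        ⟨by linarith, by linarith [mul_nonneg (Nat.cast_nonneg (α := ℝ) K) hc0]⟩
      have hl2 : (φ (1 - X) - φ (1 - K * c)) ^ 2 ≤ A ^ 2 * (X - K * c) ^ 2 := by
        rw [← sq_abs, ← mul_pow, ← sq_abs (A * _)]
        refine pow_le_pow_left₀ (abs_nonneg _) (hl.trans ?_) 2
        rw [abs_mul, show 1 - X - (1 - K * c) = -(X - K * c) by ring, abs_neg]
        exact mul_le_mul_of_nonneg_right (le_abs_self A) (abs_nonneg _)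
      rw [hD, hθ]
      nlinarith [sq_nonneg ((∑ i, φ (x (u i)) - K * μ) - 8 * (φ (1 - X) - φ (1 - K * c)))]
    calc 5 / 8 * ∑ N, ∑ y, f N y * (est (Fin.cons (y : ℕ) fun i => (N i : ℕ)) -
          (K * μ + φ (1 - K * c))) ^ 2
        ≤ ∑ N, ∑ y, (f N y * (est (Fin.cons (y : ℕ) fun i => (N i : ℕ)) - θ) ^ 2 +
            5 / 3 * D * f N y) := by
          simp_rw [Finset.mul_sum]
          refine Finset.sum_le_sum fun N _ => Finset.sum_le_sum fun y _ => ?_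
          set z := est (Fin.cons (y : ℕ) fun i => (N i : ℕ))
          -- `5 / 8 * (a + b) ^ 2 ≤ a ^ 2 + 5 / 3 * b ^ 2`, by completing the square
          have : 5 / 8 * (z - (K * μ + φ (1 - K * c))) ^ 2 ≤ (z - θ) ^ 2 + 5 / 3 * D := by
            rw [hD]
            nlinarith [sq_nonneg (3 * (z - (K * μ + φ (1 - K * c))) -
              8 * (θ - (K * μ + φ (1 - K * c))))]
          have := mul_le_mul_of_nonneg_left this (hf0 N y)
          linarith
      _ ≤ R + 5 / 3 * D := by
          simp_rw [Finset.sum_add_distrib, ← Finset.mul_sum]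
          have hD0 : 0 ≤ 5 / 3 * D := by positivity
          exact add_le_add hR' (mul_le_of_le_one_right hD0 hf1)
      _ ≤ _ := by linarith
  refine (Finset.sum_le_sum fun u _ => hu u).trans ?_
  have e1 := sum_prod_weight_mul_sub_mean_sq_le (h := fun a => φ (x a)) hw1 K
  have e2 := sum_prod_weight_mul_sub_mean_sq_le (h := x) hw1 K
  rw [hmean] at e2
  have hsplit : ∑ u : Fin K → ι, (∏ i, w (u i)) * (R + (15 / 8 * (∑ i, φ (x (u i)) - K * μ) ^ 2 +
        15 * A ^ 2 * (∑ i, x (u i) - K * c) ^ 2)) =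
      R * ∑ u : Fin K → ι, ∏ i, w (u i) +
      15 / 8 * ∑ u : Fin K → ι, (∏ i, w (u i)) * (∑ i, φ (x (u i)) - K * μ) ^ 2 +
      15 * A ^ 2 * ∑ u : Fin K → ι, (∏ i, w (u i)) * (∑ i, x (u i) - K * c) ^ 2 := by
    simp_rw [Finset.mul_sum, ← Finset.sum_add_distrib]
    exact Finset.sum_congr rfl fun u _ => by ring
  rw [hsplit, sum_prod_weight hw1]
  have hK : (0 : ℝ) ≤ K := Nat.cast_nonneg K
  have f1 := e1.trans (mul_le_mul_of_nonneg_left hv₁ hK)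
  have f2 := e2.trans (mul_le_mul_of_nonneg_left hv₂ hK)
  have f3 := mul_le_mul_of_nonneg_left f2 (by positivity : 0 ≤ 15 * A ^ 2)
  linarith

/-- The method of two priors, in terms of an upper bound `R` for the risk of an estimator over the
simplex: `K` coordinates are drawn independently from one of two priors with matched moments, and
one more coordinate carries the remaining mass. -/
lemma two_prior_bound {φ : ℝ → ℝ} {x w w' : ι → ℝ}
    {m M A c v₁ v₂ R ε s ψ : ℝ} {K L : ℕ}
    (hm : 0 ≤ m) (hM : 0 ≤ M) (hx : ∀ a, 0 ≤ x a) (hxM : ∀ a, x a ≤ M)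
    (hw : ∀ a, 0 ≤ w a) (hw' : ∀ a, 0 ≤ w' a) (hw1 : ∑ a, w a = 1) (hw1' : ∑ a, w' a = 1)
    (hmean : ∑ a, w a * x a = c) (hmean' : ∑ a, w' a * x a = c) (hKc : K * c ≤ 1)
    (hmom : ∀ l ≤ L, ∑ a, (w a - w' a) * x a ^ l = 0)
    (hε : ∀ n, ∑ l ∈ Finset.range n,
      (if l ≤ L then 0 else (2 * (m * M)) ^ l / (l.factorial : ℝ)) ≤ ε)
    (hs : 0 ≤ s) (hψ1 : 1 ≤ ψ) (hψ : ∑ a, w a * Real.exp (s * x a) ≤ ψ)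
    (hψ' : ∑ a, w' a * Real.exp (s * x a) ≤ ψ)
    (hLip : ∀ p ∈ Icc (0 : ℝ) 1, ∀ q ∈ Icc (0 : ℝ) 1, |φ p - φ q| ≤ A * |p - q|)
    (hv₁ : ∑ a, w a * φ (x a) ^ 2 ≤ v₁) (hv₁' : ∑ a, w' a * φ (x a) ^ 2 ≤ v₁)
    (hv₂ : ∑ a, w a * x a ^ 2 ≤ v₂) (hv₂' : ∑ a, w' a * x a ^ 2 ≤ v₂) (hR : 0 ≤ R)
    (est : (Fin (K + 1) → ℕ) → ℝ)
    (hest : ∀ B : ℕ, ∀ P ∈ stdSimplex ℝ (Fin (K + 1)), ∑ N : Fin K → Fin B, ∑ y : Fin B,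
      (∏ i, poissonWeight (m * P i.succ) (N i)) * poissonWeight (m * P 0) y *
        (est (Fin.cons (y : ℕ) fun i => (N i : ℕ)) - theta φ P) ^ 2 ≤ R) :
    5 / 16 * (K * ∑ a, (w a - w' a) * φ (x a)) ^ 2 *
      (1 - Real.exp (-s) * ψ ^ K - K * (ε + 2 * (Real.exp (-(s * (1 - M))) * ψ ^ K))) ≤
      2 * (R + K * (15 / 8 * v₁ + 15 * A ^ 2 * v₂)) := by
  set Δ := K * ∑ a, (w a - w' a) * φ (x a) with hΔ
  set τ := K * (ε + 2 * (Real.exp (-(s * (1 - M))) * ψ ^ K)) with hτ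
  set mass := ∑ u : Fin K → ι, (∏ i, w (u i)) * (if ∑ i, x (u i) ≤ 1 then 1 else 0) with hmass
  have hmass_ge : 1 - Real.exp (-s) * ψ ^ K ≤ mass := by
    have := one_sub_le_sum_prod_weight_indicator hw hw1 hs hψ K 1
    rwa [mul_one] at this
  have hlim : Filter.Tendsto (fun B : ℕ => 5 / 16 * Δ ^ 2 * ((∑ N : Fin K → Fin B, ∑ y : Fin B,
      truncatedMixture m x w 1 (fun i => (N i : ℕ)) y) - τ)) Filter.atTop
      (nhds (5 / 16 * Δ ^ 2 * (mass - τ))) :=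
    ((tendsto_sum_truncatedMixture m x w K 1).sub_const τ).const_mul _
  have hB : ∀ B : ℕ, 5 / 16 * Δ ^ 2 * ((∑ N : Fin K → Fin B, ∑ y : Fin B,
      truncatedMixture m x w 1 (fun i => (N i : ℕ)) y) - τ) ≤
      2 * (R + K * (15 / 8 * v₁ + 15 * A ^ 2 * v₂)) := by
    intro B
    have h1 := sum_truncatedMixture_sq_le hm hx hw hw1 hmean hKc hLip hv₁ hv₂ hR est B (hest B)
    have h2 := sum_truncatedMixture_sq_le hm hx hw' hw1' hmean' hKc hLip hv₁' hv₂' hR est B (hest B)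
    have htv := sum_abs_truncatedMixture_sub_le hm hM hx hxM hw hw' hw1 hw1' hmom hε hs hψ1 hψ hψ'
      B K 1
    rw [← hτ] at htv
    set μ := K * ∑ a, w a * φ (x a) + φ (1 - K * c) with hμ
    set μ' := K * ∑ a, w' a * φ (x a) + φ (1 - K * c) with hμ'
    have hΔμ : Δ = μ - μ' := by
      rw [hΔ, hμ, hμ']
      simp_rw [sub_mul, Finset.sum_sub_distrib]
      ring
    set g : (Fin K → Fin B) → Fin B → ℝ := fun N y =>
      truncatedMixture m x w 1 (fun i => (N i : ℕ)) y with hg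
    set g' : (Fin K → Fin B) → Fin B → ℝ := fun N y =>
      truncatedMixture m x w' 1 (fun i => (N i : ℕ)) y with hg'
    have hpt : ∑ N, ∑ y, 5 / 16 * Δ ^ 2 * (g N y - |g N y - g' N y|) ≤
        ∑ N, ∑ y, (5 / 8 * (g N y * (est (Fin.cons (y : ℕ) fun i => (N i : ℕ)) - μ) ^ 2) +
          5 / 8 * (g' N y * (est (Fin.cons (y : ℕ) fun i => (N i : ℕ)) - μ') ^ 2)) := by
      refine Finset.sum_le_sum fun N _ => Finset.sum_le_sum fun y _ => ?_
      set z := est (Fin.cons (y : ℕ) fun i => (N i : ℕ))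
      have hg0 : 0 ≤ g N y := truncatedMixture_nonneg hm hx hw _ _ _
      have hg0' : 0 ≤ g' N y := truncatedMixture_nonneg hm hx hw' _ _ _
      -- `t` is at most the minimum of the two masses
      set t := g N y - |g N y - g' N y|
      have ht1 : t ≤ g N y := sub_le_self _ (abs_nonneg _)
      have ht2 : t ≤ g' N y := by
        have := le_abs_self (g N y - g' N y)
        simp only [t]; linarith
      have hsq : Δ ^ 2 ≤ 2 * ((z - μ) ^ 2 + (z - μ') ^ 2) := by
        rw [hΔμ]; nlinarith [sq_nonneg ((z - μ) + (z - μ'))]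
      have p1 := mul_le_mul_of_nonneg_right ht1 (sq_nonneg (z - μ))
      have p2 := mul_le_mul_of_nonneg_right ht2 (sq_nonneg (z - μ'))
      rcases le_total 0 t with ht | ht
      · have := mul_le_mul_of_nonneg_left hsq ht
        linarith
      · have := mul_nonpos_of_nonpos_of_nonneg ht (sq_nonneg Δ)
        have q1 := mul_nonneg hg0 (sq_nonneg (z - μ))
        have q2 := mul_nonneg hg0' (sq_nonneg (z - μ'))
        linarith
    simp_rw [Finset.sum_add_distrib, ← Finset.mul_sum, Finset.sum_sub_distrib] at hpt
    have h3 : 5 / 16 * Δ ^ 2 * ((∑ N, ∑ y, g N y) - τ) ≤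
        5 / 16 * Δ ^ 2 * ((∑ N, ∑ y, g N y) - ∑ N, ∑ y, |g N y - g' N y|) :=
      mul_le_mul_of_nonneg_left (by linarith) (by positivity)
    linarith
  have h4 := le_of_tendsto' hlim hB
  have h5 : 5 / 16 * Δ ^ 2 * (1 - Real.exp (-s) * ψ ^ K - τ) ≤ 5 / 16 * Δ ^ 2 * (mass - τ) :=
    mul_le_mul_of_nonneg_left (by linarith) (by positivity)
  exact h5.trans h4

/-! ### Passing from the risk to finite sums -/

lemma histogramLaw_singleton {k : ℕ} {m : ℝ} {P : Fin k → ℝ} (h : ∀ i, 0 ≤ m * P i)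
    (N : Fin k → ℕ) :
    histogramLaw m P {N} = ENNReal.ofReal (∏ i, poissonWeight (m * P i) (N i)) := by
  rw [histogramLaw, Measure.pi_singleton,
    ENNReal.ofReal_prod_of_nonneg fun i _ => poissonWeight_nonneg (h i) _]
  refine Finset.prod_congr rfl fun i _ => ?_
  rw [poissonMeasure_singleton, Real.coe_toNNReal _ (h i), poissonWeight, mul_div_assoc]

lemma sum_poissonWeight_mul_sq_le_poissonRisk {K : ℕ} {m : ℝ} (hm : 0 ≤ m) (φ : ℝ → ℝ)
    (est : (Fin (K + 1) → ℕ) → ℝ) {P : Fin (K + 1) → ℝ} (hP : ∀ i, 0 ≤ P i) (B : ℕ) :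
    ENNReal.ofReal (∑ N : Fin K → Fin B, ∑ y : Fin B,
      (∏ i, poissonWeight (m * P i.succ) (N i)) * poissonWeight (m * P 0) y *
        (est (Fin.cons (y : ℕ) fun i => (N i : ℕ)) - theta φ P) ^ 2) ≤ poissonRisk m φ est P := by
  have h0 : ∀ i, 0 ≤ m * P i := fun i => mul_nonneg hm (hP i)
  rw [poissonRisk, lintegral_countable', ← Fintype.sum_prod_type',
    ENNReal.ofReal_sum_of_nonneg]
  swap
  · intro p _
    exact mul_nonneg (mul_nonneg (Finset.prod_nonneg fun i _ => poissonWeight_nonneg (h0 _) _)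
      (poissonWeight_nonneg (h0 _) _)) (sq_nonneg _)
  let emb : (Fin K → Fin B) × Fin B → (Fin (K + 1) → ℕ) :=
    fun p => Fin.cons (p.2 : ℕ) fun i => (p.1 i : ℕ)
  have hemb : Function.Injective emb := by
    rintro ⟨N, y⟩ ⟨N', y'⟩ h
    have hh := Fin.cons_inj.1 h
    refine Prod.ext (funext fun i => Fin.ext (congrFun hh.2 i)) (Fin.ext hh.1)
  refine le_trans (le_of_eq ?_) (ENNReal.tsum_comp_le_tsum_of_injective hemb
    fun N => ENNReal.ofReal ((est N - theta φ P) ^ 2) * histogramLaw m P {N})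
  rw [tsum_fintype]
  refine Finset.sum_congr rfl fun p _ => ?_
  rw [histogramLaw_singleton h0, ← ENNReal.ofReal_mul (sq_nonneg _)]
  congr 1
  simp only [emb, Fin.prod_univ_succ, Fin.cons_zero, Fin.cons_succ]
  ring

/-- A lower bound for every real upper bound of the risk is a lower bound for the minimax risk. -/
lemma ofReal_le_poissonMinimaxRisk {K : ℕ} {m : ℝ} (hm : 0 ≤ m) (φ : ℝ → ℝ) (b : ℝ)
    (h : ∀ (est : (Fin (K + 1) → ℕ) → ℝ) (R : ℝ), 0 ≤ R →
      (∀ B : ℕ, ∀ P ∈ stdSimplex ℝ (Fin (K + 1)), ∑ N : Fin K → Fin B, ∑ y : Fin B,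
        (∏ i, poissonWeight (m * P i.succ) (N i)) * poissonWeight (m * P 0) y *
          (est (Fin.cons (y : ℕ) fun i => (N i : ℕ)) - theta φ P) ^ 2 ≤ R) → b ≤ R) :
    ENNReal.ofReal b ≤ poissonMinimaxRisk m (K + 1) φ := by
  refine le_iInf fun est => ?_
  set S := ⨆ P ∈ stdSimplex ℝ (Fin (K + 1)), poissonRisk m φ est P with hS
  by_cases htop : S = ⊤
  · rw [htop]; exact le_top
  refine ENNReal.ofReal_le_of_le_toReal (h est S.toReal ENNReal.toReal_nonneg fun B P hP => ?_)
  refine (ENNReal.ofReal_le_iff_le_toReal htop).1 ?_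
  exact (sum_poissonWeight_mul_sq_le_poissonRisk hm φ est hP.1 B).trans
    (le_iSup₂ (f := fun P (_ : P ∈ stdSimplex ℝ (Fin (K + 1))) => poissonRisk m φ est P) P hP)

/-! ### Hölder seminorms -/

lemma holderSeminorm_nonneg (β : ℝ) (f : ℝ → ℝ) : 0 ≤ holderSeminorm β f := NNReal.coe_nonneg _

lemma IsHolderOnUnit.abs_sub_le {β : ℝ} {f : ℝ → ℝ} (hβ : 0 ≤ β) (h : IsHolderOnUnit β f) :
    ∀ p ∈ Icc (0 : ℝ) 1, ∀ q ∈ Icc (0 : ℝ) 1,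
      |f p - f q| ≤ holderSeminorm β f * |p - q| ^ β := by
  intro p hp q hq
  have := h.holderWith.dist_le ⟨p, hp⟩ ⟨q, hq⟩
  rw [Real.coe_toNNReal β hβ] at this
  simpa [Real.dist_eq, Subtype.dist_eq, holderSeminorm] using this

lemma abs_le_holderSeminorm_unitDeriv_mul_rpow {φ : ℝ → ℝ} {α : ℝ} (hα : 1 < α) (hφ0 : φ 0 = 0)
    (hdiff : DifferentiableOn ℝ φ (Icc 0 1)) (hHol : IsHolderOnUnit (α - 1) (unitDeriv φ))
    (hφ'0 : unitDeriv φ 0 = 0) {p : ℝ} (hp : p ∈ Icc (0 : ℝ) 1) :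
    |φ p| ≤ holderSeminorm (α - 1) (unitDeriv φ) * p ^ α := by
  have hα0 : 0 ≤ α - 1 := by linarith
  have hsub : Icc 0 p ⊆ Icc (0 : ℝ) 1 := Icc_subset_Icc_right hp.2
  have h := Convex.norm_image_sub_le_of_norm_hasDerivWithin_le (f := φ) (f' := unitDeriv φ)
    (s := Icc 0 p) (x := 0) (y := p)
    (C := holderSeminorm (α - 1) (unitDeriv φ) * p ^ (α - 1))
    (fun t ht => ((hdiff t (hsub ht)).hasDerivWithinAt).mono hsub)
    (fun t ht => by
      have := hHol.abs_sub_le hα0 t (hsub ht) 0 ⟨le_rfl, zero_le_one⟩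
      rw [hφ'0, sub_zero, sub_zero, abs_of_nonneg ht.1] at this
      rw [Real.norm_eq_abs]
      exact this.trans (mul_le_mul_of_nonneg_left (Real.rpow_le_rpow ht.1 ht.2 hα0)
        (holderSeminorm_nonneg _ _)))
    (convex_Icc 0 p) ⟨le_rfl, hp.1⟩ ⟨hp.1, le_rfl⟩
  rw [hφ0, sub_zero, sub_zero, Real.norm_eq_abs, Real.norm_eq_abs, abs_of_nonneg hp.1,
    mul_assoc] at h
  rcases hp.1.eq_or_lt with h0 | h0
  · rw [← h0, hφ0, abs_zero, Real.zero_rpow (by linarith), mul_zero]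
  · rwa [← Real.rpow_add_one h0.ne', sub_add_cancel] at h

/-! ### Numerical estimates -/

lemma pow_div_factorial_le {z : ℝ} (hz : 0 ≤ z) {L l : ℕ} (hL : 0 < L) (hl : L ≤ l) :
    z ^ l / (l.factorial : ℝ) ≤ (Real.exp 1 * z / L) ^ l := by
  have hL' : (0 : ℝ) < L := Nat.cast_pos.2 hL
  have hl' : (0 : ℝ) < l := Nat.cast_pos.2 (hL.trans_le hl)
  have h := Real.pow_div_factorial_le_exp (l : ℝ) hl'.le l
  have he : Real.exp (l : ℝ) = Real.exp 1 ^ l := by rw [← Real.exp_nat_mul, mul_one]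
  rw [he] at h
  calc z ^ l / (l.factorial : ℝ) = (z / l) ^ l * ((l : ℝ) ^ l / l.factorial) := by
        rw [div_pow]; field_simp
    _ ≤ (z / L) ^ l * Real.exp 1 ^ l := by
        refine mul_le_mul (pow_le_pow_left₀ (by positivity) ?_ _) h (by positivity) (by positivity)
        exact div_le_div_of_nonneg_left hz hL' (Nat.cast_le.2 hl)
    _ = _ := by rw [← mul_pow]; congr 1; ring

/-- The tail of the exponential series beyond `L`. -/
lemma exp_series_tail_le {z : ℝ} (hz : 0 ≤ z) {L : ℕ} (hL : 0 < L)
    (h : 2 * Real.exp 1 * z / L ≤ 1) (n : ℕ) :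
    ∑ l ∈ Finset.range n, (if l ≤ L then 0 else z ^ l / (l.factorial : ℝ)) ≤
      (2 * Real.exp 1 * z / L) ^ L / 2 := by
  set ρ := 2 * Real.exp 1 * z / L with hρ
  have hρ0 : 0 ≤ ρ := by positivity
  have hterm : ∀ l, (if l ≤ L then 0 else z ^ l / (l.factorial : ℝ)) ≤
      ρ ^ L * if l ≤ L then 0 else (1 / 2 : ℝ) ^ l := by
    intro l
    split_ifs with hl
    · simp
    · have hl' : L ≤ l := (not_le.1 hl).le
      refine (pow_div_factorial_le hz hL hl').trans ?_
      have : Real.exp 1 * z / L = ρ * (1 / 2) := by rw [hρ]; ring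
      rw [this, mul_pow]
      exact mul_le_mul_of_nonneg_right (pow_le_pow_of_le_one hρ0 h hl') (by positivity)
  have hgeom : ∀ n, ∑ l ∈ Finset.range (L + 1 + n), (if l ≤ L then 0 else (1 / 2 : ℝ) ^ l) =
      (1 / 2) ^ L - (1 / 2) ^ (L + n) := by
    intro n
    induction n with
    | zero =>
      rw [add_zero, add_zero, sub_self]
      refine Finset.sum_eq_zero fun l hl => ?_
      rw [if_pos (Nat.lt_succ_iff.1 (Finset.mem_range.1 hl))]
    | succ n ih =>
      rw [← add_assoc, Finset.sum_range_succ, ih, if_neg (by omega),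
        show L + 1 + n = L + n + 1 by omega, ← add_assoc, pow_succ]
      ring
  have hhalf : ∑ l ∈ Finset.range n, (if l ≤ L then 0 else (1 / 2 : ℝ) ^ l) ≤ 1 / 2 := by
    calc _ ≤ ∑ l ∈ Finset.range (L + 1 + n), (if l ≤ L then 0 else (1 / 2 : ℝ) ^ l) := by
          refine Finset.sum_le_sum_of_subset_of_nonneg (Finset.range_mono (by omega)) ?_
          intro l _ _
          split_ifs <;> positivity
      _ ≤ (1 / 2) ^ L := by
          rw [hgeom]
          exact sub_le_self _ (by positivity)
      _ ≤ (1 / 2) ^ 1 := pow_le_pow_of_le_one (by norm_num) (by norm_num) hL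
      _ = 1 / 2 := pow_one _
  calc _ ≤ ∑ l ∈ Finset.range n, ρ ^ L * (if l ≤ L then 0 else (1 / 2 : ℝ) ^ l) :=
        Finset.sum_le_sum fun l _ => hterm l
    _ = ρ ^ L * ∑ l ∈ Finset.range n, (if l ≤ L then 0 else (1 / 2 : ℝ) ^ l) := by
        rw [Finset.mul_sum]
    _ ≤ ρ ^ L * (1 / 2) := mul_le_mul_of_nonneg_left hhalf (by positivity)
    _ = _ := by ring

/-- The chord bound for the exponential on `[0, 1]`. -/
lemma exp_le_one_add_mul {t : ℝ} (h0 : 0 ≤ t) (h1 : t ≤ 1) :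
    Real.exp t ≤ 1 + (Real.exp 1 - 1) * t := by
  have := convexOn_exp.2 (mem_univ (0 : ℝ)) (mem_univ (1 : ℝ)) (sub_nonneg.2 h1) h0
    (sub_add_cancel 1 t)
  simp only [smul_eq_mul, mul_zero, mul_one, zero_add, Real.exp_zero] at this
  linarith

lemma sum_weight_mul_exp_le {x w : ι → ℝ} {M c : ℝ} (hM : 0 < M)
    (hx : ∀ a, 0 ≤ x a) (hxM : ∀ a, x a ≤ M) (hw : ∀ a, 0 ≤ w a) (hw1 : ∑ a, w a = 1)
    (hmean : ∑ a, w a * x a = c) :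
    ∑ a, w a * Real.exp (M⁻¹ * x a) ≤ 1 + (Real.exp 1 - 1) * c / M := by
  calc ∑ a, w a * Real.exp (M⁻¹ * x a)
      ≤ ∑ a, w a * (1 + (Real.exp 1 - 1) * (M⁻¹ * x a)) :=
        Finset.sum_le_sum fun a _ => mul_le_mul_of_nonneg_left
          (exp_le_one_add_mul (mul_nonneg (inv_nonneg.2 hM.le) (hx a))
            ((inv_mul_le_one₀ hM).2 (hxM a))) (hw a)
    _ = ∑ a, w a + (Real.exp 1 - 1) / M * ∑ a, w a * x a := by
        rw [Finset.mul_sum, ← Finset.sum_add_distrib]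
        exact Finset.sum_congr rfl fun a _ => by ring
    _ = _ := by rw [hw1, hmean]; ring

/-- The probability that `K` draws of mean `c` in `[0, M]` exceed the available mass is negligible
even after multiplication by the alphabet size `k`, if `M` is small compared with `1 / √k`. -/
lemma tail_bound {k M c : ℝ} {K : ℕ} (hk : 146 < k) (hKk : K ≤ k) (hM : 0 < M)
    (hMk : M * √k < 1 / 12) (hc : 0 ≤ c) (hKc : K * c ≤ 1 / 2) :
    Real.exp (-M⁻¹) * (1 + (Real.exp 1 - 1) * c / M) ^ K +
      K * (2 * (Real.exp (-(M⁻¹ * (1 - M))) * (1 + (Real.exp 1 - 1) * c / M) ^ K)) ≤ 1 / 8 := by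
  have he1 : Real.exp 1 < 2.72 := Real.exp_one_lt_d9.trans (by norm_num)
  have he0 : 0 < Real.exp 1 - 1 := by
    have := Real.add_one_lt_exp (one_ne_zero (α := ℝ)); linarith
  have hk0 : 0 < k := by linarith
  have ht0 : 0 < √k := Real.sqrt_pos.2 hk0
  have htk : √k ^ 2 = k := Real.sq_sqrt hk0.le
  set ψ := 1 + (Real.exp 1 - 1) * c / M
  set τ := Real.exp (-M⁻¹) * ψ ^ K with hτ
  have hs : Real.exp (-(M⁻¹ * (1 - M))) = Real.exp 1 * Real.exp (-M⁻¹) := by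
    rw [← Real.exp_add]; congr 1; field_simp; ring
  have hMinv : 12 * √k ≤ M⁻¹ := by
    rw [le_inv_comm₀ (by positivity) hM, ← one_div, le_div_iff₀ (by positivity)]
    linarith
  have hψ0 : 0 ≤ ψ := by positivity
  -- `0.86 = (2.72 - 1) / 2`, with `e < 2.72` and `K * c ≤ 1 / 2`
  have hψK : ψ ^ K ≤ Real.exp (0.86 * M⁻¹) := by
    calc ψ ^ K ≤ Real.exp ((Real.exp 1 - 1) * c / M) ^ K := by
          refine pow_le_pow_left₀ hψ0 ?_ K
          have := Real.add_one_le_exp ((Real.exp 1 - 1) * c / M)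
          linarith
      _ = Real.exp ((Real.exp 1 - 1) * (K * c) * M⁻¹) := by
          rw [← Real.exp_nat_mul]; congr 1; ring
      _ ≤ Real.exp (0.86 * M⁻¹) := by
          refine Real.exp_le_exp.2 (mul_le_mul_of_nonneg_right ?_ (by positivity))
          have := mul_le_mul_of_nonneg_left hKc he0.le
          linarith
  have hτle : τ ≤ Real.exp (-(1.68 * √k)) := by
    calc τ ≤ Real.exp (-M⁻¹) * Real.exp (0.86 * M⁻¹) :=
          mul_le_mul_of_nonneg_left hψK (Real.exp_pos _).le
      _ = Real.exp (-(0.14 * M⁻¹)) := by rw [← Real.exp_add]; congr 1; ring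
      _ ≤ _ := Real.exp_le_exp.2 (by linarith)
  -- the fourth term of the exponential series beats `k ^ 2`, hence `K * τ` is of order `1 / k`
  have hexp : 0.33 * k ^ 2 ≤ Real.exp (1.68 * √k) := by
    have h4 := Real.pow_div_factorial_le_exp (1.68 * √k) (by positivity) 4
    have : (1.68 * √k) ^ 4 = 1.68 ^ 4 * k ^ 2 := by
      rw [mul_pow, show √k ^ 4 = (√k ^ 2) ^ 2 by ring, htk]
    rw [this] at h4
    norm_num [Nat.factorial] at h4 ⊢
    nlinarith [sq_nonneg k]
  have hτk : τ * (0.33 * k ^ 2) ≤ 1 := by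
    calc τ * (0.33 * k ^ 2) ≤ Real.exp (-(1.68 * √k)) * Real.exp (1.68 * √k) :=
          mul_le_mul hτle hexp (by positivity) (Real.exp_pos _).le
      _ = 1 := by rw [← Real.exp_add, neg_add_cancel, Real.exp_zero]
  have hτ0 : 0 ≤ τ := by positivity
  rw [hs, mul_assoc (Real.exp 1), ← hτ]
  have hKe : K * (2 * (Real.exp 1 * τ)) ≤ 5.44 * k * τ := by
    have h1 : K * Real.exp 1 ≤ k * 2.72 := mul_le_mul hKk he1.le (Real.exp_pos _).le hk0.le
    have := mul_le_mul_of_nonneg_right h1 hτ0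
    linarith
  have h1k : τ ≤ 0.01 * k * τ := by nlinarith
  have hτk' : τ * k * 0.33 * 146 ≤ 1 := by
    have : τ * k * 0.33 * 146 ≤ τ * k * 0.33 * k :=
      mul_le_mul_of_nonneg_left hk.le (by positivity)
    calc _ ≤ _ := this
      _ = τ * (0.33 * k ^ 2) := by ring
      _ ≤ 1 := hτk
  linarith

/-! ### The lower bound -/

/-- The bound for a single estimator, in the regime where it is not trivial: the alphabet is large
and the tail of the exponential series is small. The constants absorb the halved prior mean, the
coordinate spent on compensation and the discarded draws. -/
lemma risk_lower_bound {φ : ℝ → ℝ} {α : ℝ} (hα : 1 < α)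
    (hφ0 : φ 0 = 0) (hLip : IsHolderOnUnit 1 φ) (hdiff : DifferentiableOn ℝ φ (Icc 0 1))
    (hHol : IsHolderOnUnit (α - 1) (unitDeriv φ)) (hφ'0 : unitDeriv φ 0 = 0)
    {n K L : ℕ} (hL : 0 < L) {k lam γ E R : ℝ} (hk : k = K + 1) (hk146 : 146 < k)
    (hlamk : lam ≤ k) (hγ0 : 0 < γ) (hγlam : γ ≤ lam / k) (hkγ : k * γ ≤ 1)
    (hlam : lam / √k < 1 / 12)
    (hE : E = bestApproxError L (fun p => φ p / p) (Icc γ (lam / k))) (hE0 : 0 < E)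
    (hq : 2 * Real.exp 1 * n * lam / (k * L) ≤ 1) (hR : 0 ≤ R)
    (est : (Fin (K + 1) → ℕ) → ℝ)
    (hest : ∀ B : ℕ, ∀ P ∈ stdSimplex ℝ (Fin (K + 1)), ∑ N : Fin K → Fin B, ∑ y : Fin B,
      (∏ i, poissonWeight (n / 2 * P i.succ) (N i)) * poissonWeight (n / 2 * P 0) y *
        (est (Fin.cons (y : ℕ) fun i => (N i : ℕ)) - theta φ P) ^ 2 ≤ R)
    (hq' : k * (2 * Real.exp 1 * n * lam / (k * L)) ^ L ≤ 7 / 8) :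
    (2 * k * γ * E) ^ 2 / 32 * (7 / 8 - k * (2 * Real.exp 1 * n * lam / (k * L)) ^ L) ≤
      R + holderSeminorm (α - 1) (unitDeriv φ) ^ 2 * (lam ^ (2 * α) / k ^ (2 * α - 1)) +
        16 * holderSeminorm 1 φ ^ 2 * (lam ^ 2 / k) := by
  have hk0 : 0 < k := by linarith
  set M := lam / k with hMdef
  have hM0 : 0 < M := hγ0.trans_le hγlam
  have hM1 : M ≤ 1 := (div_le_one hk0).2 hlamk
  have hlam0 : 0 < lam := by
    have : lam = M * k := by rw [hMdef]; field_simp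
    rw [this]; positivity
  set A := holderSeminorm 1 φ
  set A' := holderSeminorm (α - 1) (unitDeriv φ)
  have hKk : (K : ℝ) ≤ k := by linarith
  have hKγ : K * (γ / 2) ≤ 1 / 2 := by
    have := mul_le_mul_of_nonneg_right hKk hγ0.le
    linarith
  have hLip' : ∀ p ∈ Icc (0 : ℝ) 1, ∀ q ∈ Icc (0 : ℝ) 1, |φ p - φ q| ≤ A * |p - q| := by
    intro p hp q hq
    simpa using hLip.abs_sub_le zero_le_one p hp q hq
  obtain ⟨ι, _, x, w, w', hx, hxM, hw, hw', hw1, hw1', hmean, hmean', hmom, hgap⟩ :=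
    exists_matching_priors hφ0 hγ0 hM0.le L (c := γ / 2) (by linarith) (by linarith)
      (e := 0.99 * E) (by positivity) (by rw [← hE]; linarith)
  have hmM : 2 * ((n : ℝ) / 2 * M) = n * lam / k := by rw [hMdef]; ring
  have hq_eq : 2 * Real.exp 1 * (n * lam / k) / L = 2 * Real.exp 1 * n * lam / (k * L) := by
    have : (L : ℝ) ≠ 0 := (Nat.cast_pos.2 hL).ne'
    field_simp
  set q := (2 * Real.exp 1 * n * lam / (k * L)) ^ L with hqdef
  have hε : ∀ N, ∑ l ∈ Finset.range N,
      (if l ≤ L then 0 else (2 * ((n : ℝ) / 2 * M)) ^ l / (l.factorial : ℝ)) ≤ q / 2 := by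
    intro N
    rw [hmM, hqdef, ← hq_eq]
    exact exp_series_tail_le (by positivity) hL (by rw [hq_eq]; exact hq) N
  have he0 : 0 < Real.exp 1 - 1 := by
    have := Real.add_one_lt_exp (one_ne_zero (α := ℝ)); linarith
  -- second moments of the prior
  have hφ2 : ∀ a, φ (x a) ^ 2 ≤ A' ^ 2 * M ^ (2 * α - 1) * x a := by
    intro a
    have h1 := abs_le_holderSeminorm_unitDeriv_mul_rpow hα hφ0 hdiff hHol hφ'0
      ⟨hx a, (hxM a).trans hM1⟩
    have h2 : φ (x a) ^ 2 ≤ (A' * x a ^ α) ^ 2 := by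
      rw [← sq_abs]; exact pow_le_pow_left₀ (abs_nonneg _) h1 2
    refine h2.trans ?_
    rcases (hx a).eq_or_lt with h0 | h0
    · rw [← h0, Real.zero_rpow (by linarith)]; simp
    · have h3 : (x a ^ α) ^ 2 = x a ^ (2 * α - 1) * x a := by
        rw [← Real.rpow_add_one h0.ne', ← Real.rpow_mul_natCast h0.le]
        congr 1; push_cast; ring
      rw [mul_pow, h3, ← mul_assoc]
      refine mul_le_mul_of_nonneg_right ?_ h0.le
      exact mul_le_mul_of_nonneg_left (Real.rpow_le_rpow h0.le (hxM a) (by linarith)) (sq_nonneg _)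
  have hv₁ : ∀ v : ι → ℝ, (∀ a, 0 ≤ v a) → ∑ a, v a * x a = γ / 2 →
      ∑ a, v a * φ (x a) ^ 2 ≤ A' ^ 2 * M ^ (2 * α - 1) * (γ / 2) := by
    intro v hv hvm
    rw [← hvm, Finset.mul_sum]
    refine Finset.sum_le_sum fun a _ => ?_
    have := mul_le_mul_of_nonneg_left (hφ2 a) (hv a)
    linarith
  have hv₂ : ∀ v : ι → ℝ, (∀ a, 0 ≤ v a) → ∑ a, v a * x a = γ / 2 →
      ∑ a, v a * x a ^ 2 ≤ M * (γ / 2) := by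
    intro v hv hvm
    rw [← hvm, Finset.mul_sum]
    refine Finset.sum_le_sum fun a _ => ?_
    have := mul_le_mul_of_nonneg_left (mul_le_mul_of_nonneg_right (hxM a) (hx a)) (hv a)
    linarith
  have hψ1 : 1 ≤ 1 + (Real.exp 1 - 1) * (γ / 2) / M := by
    have : 0 ≤ (Real.exp 1 - 1) * (γ / 2) / M := by positivity
    linarith
  have main := two_prior_bound (m := (n : ℝ) / 2) (s := M⁻¹) (by positivity) hM0.le hx hxM hw hw'
    hw1 hw1' hmean hmean' (hKγ.trans (by norm_num)) hmom hε (inv_nonneg.2 hM0.le) hψ1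
    (sum_weight_mul_exp_le hM0 hx hxM hw hw1 hmean)
    (sum_weight_mul_exp_le hM0 hx hxM hw' hw1' hmean')
    hLip' (hv₁ w hw hmean) (hv₁ w' hw' hmean') (hv₂ w hw hmean) (hv₂ w' hw' hmean') hR est hest
  have hMk : M * √k < 1 / 12 := by
    have hsq : √k * √k = k := Real.mul_self_sqrt hk0.le
    have hs0 : 0 < √k := Real.sqrt_pos.2 hk0
    have : M * √k = lam / √k := by
      rw [hMdef, div_mul_eq_mul_div, div_eq_div_iff hk0.ne' hs0.ne', mul_assoc, hsq]
    rwa [this]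
  have htail := tail_bound hk146 hKk hM0 hMk (c := γ / 2) (by linarith) hKγ
  set ψ := 1 + (Real.exp 1 - 1) * (γ / 2) / M
  set G := ∑ a, (w a - w' a) * φ (x a)
  set d := 2 * k * γ * E with hd
  have hd0 : 0 ≤ d := by positivity
  -- `0.49 < 0.99 / 2 * (K / k)`: approximation slack, halved prior mean and lost coordinate
  have hΔ : 0.49 * d ≤ K * G := by
    have h1 : 145 / 146 * k ≤ K := by linarith
    have h2 : K * (γ / 2 * (2 * (0.99 * E))) ≤ K * G :=
      mul_le_mul_of_nonneg_left hgap (Nat.cast_nonneg K)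
    have h3 : 145 / 146 * k * (γ * E) ≤ K * (γ * E) :=
      mul_le_mul_of_nonneg_right h1 (by positivity)
    have h4 : 0 ≤ k * γ * E := by positivity
    rw [hd]
    linarith
  have hΔ2 : (0.49 * d) ^ 2 ≤ (K * G) ^ 2 := pow_le_pow_left₀ (by positivity) hΔ 2
  have hq0 : 0 ≤ q := by positivity
  have hKq : K * q ≤ k * q := mul_le_mul_of_nonneg_right hKk hq0
  have hbr : 7 / 8 - k * q / 2 ≤ 1 - Real.exp (-M⁻¹) * ψ ^ K -
      K * (q / 2 + 2 * (Real.exp (-(M⁻¹ * (1 - M))) * ψ ^ K)) := by linarith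
  have hbr0 : 0 ≤ 7 / 8 - k * q / 2 := by linarith
  have hlow : 5 / 16 * (0.49 * d) ^ 2 * (7 / 8 - k * q / 2) ≤
      5 / 16 * (K * G) ^ 2 * (1 - Real.exp (-M⁻¹) * ψ ^ K -
        K * (q / 2 + 2 * (Real.exp (-(M⁻¹ * (1 - M))) * ψ ^ K))) :=
    mul_le_mul (by linarith) hbr hbr0 (by positivity)
  have hfin := hlow.trans main
  have hKγlam : K * γ ≤ lam := by
    have h1 : K * γ ≤ k * γ := mul_le_mul_of_nonneg_right hKk hγ0.le
    have h2 : k * γ ≤ lam := by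
      have := mul_le_mul_of_nonneg_left hγlam hk0.le
      rwa [mul_div_cancel₀ _ hk0.ne'] at this
    exact h1.trans h2
  have hVα : M ^ (2 * α - 1) * lam = lam ^ (2 * α) / k ^ (2 * α - 1) := by
    rw [hMdef, Real.div_rpow hlam0.le hk0.le, div_mul_eq_mul_div, ← Real.rpow_add_one hlam0.ne',
      sub_add_cancel]
  have hV1 : K * (A' ^ 2 * M ^ (2 * α - 1) * (γ / 2)) ≤
      A' ^ 2 * (lam ^ (2 * α) / k ^ (2 * α - 1)) / 2 := by
    rw [← hVα]
    have h0 : 0 ≤ A' ^ 2 * M ^ (2 * α - 1) := by positivity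
    have := mul_le_mul_of_nonneg_left hKγlam h0
    linarith
  have hV2 : K * (M * (γ / 2)) ≤ lam ^ 2 / k / 2 := by
    have h1 : lam ^ 2 / k = M * lam := by rw [hMdef]; ring
    rw [h1]
    have := mul_le_mul_of_nonneg_left hKγlam hM0.le
    linarith
  have hV2' := mul_le_mul_of_nonneg_left hV2 (sq_nonneg A)
  have hX1 : 0 ≤ A' ^ 2 * (lam ^ (2 * α) / k ^ (2 * α - 1)) := by positivity
  have hX2 : 0 ≤ A ^ 2 * (lam ^ 2 / k) := by positivity
  have hmainterm : d ^ 2 / 32 * (7 / 8 - k * q) ≤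
      5 / 32 * (0.49 * d) ^ 2 * (7 / 8 - k * q / 2) := by
    have h1 : 7 / 8 - k * q ≤ 1.2 * (7 / 8 - k * q / 2) := by linarith [mul_nonneg hk0.le hq0]
    have h2 := mul_le_mul_of_nonneg_left h1 (by positivity : 0 ≤ d ^ 2 / 32)
    have h3 : 0 ≤ d ^ 2 * (7 / 8 - k * q / 2) := mul_nonneg (sq_nonneg d) hbr0
    linarith
  linarith

end AdditiveFunctional

theorem mainTheorem5 (φ : ℝ → ℝ) (α : ℝ) (hα : 1 < α) (hα2 : α ≤ 2)
    (hφ0 : φ 0 = 0)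
    (hLip : AdditiveFunctional.IsHolderOnUnit 1 φ)
    (hdiff : DifferentiableOn ℝ φ (Set.Icc 0 1))
    (hHol : AdditiveFunctional.IsHolderOnUnit (α - 1) (AdditiveFunctional.unitDeriv φ))
    (hφ'0 : AdditiveFunctional.unitDeriv φ 0 = 0)
    (n k L : ℕ) (hL : 0 < L) (lam γ : ℝ) (hlamk : lam ≤ k)
    (hγ0 : 0 < γ) (hγ1 : γ < 1) (hγlam : γ ≤ lam / k) (hkγ : k * γ ≤ 1)
    (hlam : lam / Real.sqrt k < 1 / 12)
    (d : ℝ)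
    (hd : d = 2 * k * γ *
      AdditiveFunctional.bestApproxError L (fun p => φ p / p) (Set.Icc γ (lam / k))) :
    ENNReal.ofReal (d ^ 2 / 32 *
        (7 / 8 - k * (2 * Real.exp 1 * n * lam / (k * L)) ^ L
          - 32 * AdditiveFunctional.holderSeminorm (α - 1) (AdditiveFunctional.unitDeriv φ) ^ 2
              * lam ^ (2 * α) / ((k : ℝ) ^ (2 * α - 1) * d ^ 2)
          - 128 * AdditiveFunctional.holderSeminorm 1 φ ^ 2 * Real.exp (-(n : ℝ) / 32) / d ^ 2
          - 512 * AdditiveFunctional.holderSeminorm 1 φ ^ 2 * lam ^ 2 / (k * d ^ 2)))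
      ≤ AdditiveFunctional.poissonMinimaxRisk ((n : ℝ) / 2) k φ := by
  open AdditiveFunctional in
  set A := holderSeminorm 1 φ with hA
  set A' := holderSeminorm (α - 1) (unitDeriv φ) with hA'
  set E := bestApproxError L (fun p => φ p / p) (Set.Icc γ (lam / k)) with hE
  set t₁ := 32 * A' ^ 2 * lam ^ (2 * α) / ((k : ℝ) ^ (2 * α - 1) * d ^ 2) with ht₁
  set t₂ := 128 * A ^ 2 * Real.exp (-(n : ℝ) / 32) / d ^ 2 with ht₂
  set t₃ := 512 * A ^ 2 * lam ^ 2 / (k * d ^ 2) with ht₃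
  set q := (2 * Real.exp 1 * n * lam / (k * L)) ^ L with hq
  have hk0 : 0 < (k : ℝ) := by
    rcases Nat.eq_zero_or_pos k with h | h
    · rw [h, Nat.cast_zero, div_zero] at hγlam
      linarith
    · exact Nat.cast_pos.2 h
  have hM0 : 0 < lam / k := hγ0.trans_le hγlam
  have hlam0 : 0 < lam := by
    rcases div_pos_iff.1 hM0 with h | h
    · exact h.1
    · linarith [h.2]
  have hE0 : 0 ≤ E := ENNReal.toReal_nonneg
  have hd0 : 0 ≤ d := by rw [hd]; positivity
  have hq0 : 0 ≤ q := by positivity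
  have ht₁0 : 0 ≤ t₁ := by positivity
  have ht₂0 : 0 ≤ t₂ := by positivity
  have ht₃0 : 0 ≤ t₃ := by positivity
  -- only a positive lower bound needs an argument
  rcases le_or_gt (d ^ 2 / 32 * (7 / 8 - k * q - t₁ - t₂ - t₃)) 0 with hneg | hpos
  · rw [ENNReal.ofReal_of_nonpos hneg]; exact zero_le
  have hdpos : 0 < d := by
    rcases hd0.eq_or_lt with h | h
    · rw [← h] at hpos; norm_num at hpos
    · exact h
  have hbr : 0 < 7 / 8 - k * q - t₁ - t₂ - t₃ := pos_of_mul_pos_right hpos (by positivity)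
  have hkq0 : 0 ≤ k * q := by positivity
  have hEpos : 0 < E := by
    rcases hE0.eq_or_lt with h | h
    · rw [hd, ← h, mul_zero] at hdpos; exact absurd hdpos (lt_irrefl 0)
    · exact h
  have hEA : E ≤ A := by
    refine bestApproxError_le_of_polynomial (holderSeminorm_nonneg _ _) 0 (by simp) fun p hp => ?_
    have hp0 : 0 < p := hγ0.trans_le hp.1
    have hp1 : p ≤ 1 := hp.2.trans ((div_le_one hk0).2 hlamk)
    have := hLip.abs_sub_le zero_le_one p ⟨hp0.le, hp1⟩ 0 ⟨le_rfl, zero_le_one⟩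
    rw [hφ0, sub_zero, sub_zero, Real.rpow_one, abs_of_pos hp0] at this
    rw [Polynomial.eval_zero, sub_zero, abs_div, abs_of_pos hp0, div_le_iff₀ hp0]
    exact this
  -- since `d ≤ 2 * λ * A`, the last term of the bracket forces a large alphabet
  have hk146 : 146 < (k : ℝ) := by
    have hkγlam : k * γ ≤ lam := by rwa [le_div_iff₀ hk0, mul_comm] at hγlam
    have hdA : d ≤ 2 * lam * A := by
      rw [hd, show 2 * k * γ * E = 2 * (k * γ) * E by ring]
      exact mul_le_mul (by linarith) hEA hE0 (by linarith)
    have h1 : d ^ 2 ≤ (2 * lam * A) ^ 2 := pow_le_pow_left₀ hd0 hdA 2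
    have h2 : t₃ < 7 / 8 := by linarith
    rw [ht₃, div_lt_iff₀ (by positivity)] at h2
    by_contra hcon
    have h3 : k * d ^ 2 ≤ 146 * (2 * lam * A) ^ 2 :=
      mul_le_mul (not_lt.1 hcon) h1 (by positivity) (by norm_num)
    have h4 : 0 ≤ (lam * A) ^ 2 := sq_nonneg _
    nlinarith
  have hq1 : 2 * Real.exp 1 * n * lam / (k * L) ≤ 1 := by
    by_contra hcon
    have h1 : 1 ≤ q := one_le_pow₀ (not_le.1 hcon).le
    nlinarith
  obtain ⟨K, rfl⟩ : ∃ K, k = K + 1 := Nat.exists_eq_succ_of_ne_zero (by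
    rintro rfl; simp at hk0)
  refine ofReal_le_poissonMinimaxRisk (by positivity) φ _ fun est R hR hest => ?_
  have key := risk_lower_bound hα hφ0 hLip hdiff hHol hφ'0 hL (k := ((K + 1 : ℕ) : ℝ))
    (by push_cast; ring) hk146 hlamk hγ0 hγlam hkγ hlam hE hEpos hq1 hR est hest (by linarith)
  rw [← hd] at key
  have e₁ : d ^ 2 / 32 * t₁ = A' ^ 2 * (lam ^ (2 * α) / ((K + 1 : ℕ) : ℝ) ^ (2 * α - 1)) := by
    rw [ht₁]
    have : ((K + 1 : ℕ) : ℝ) ^ (2 * α - 1) ≠ 0 := (Real.rpow_pos_of_pos hk0 _).ne'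
    field_simp
  have e₃ : d ^ 2 / 32 * t₃ = 16 * A ^ 2 * (lam ^ 2 / ((K + 1 : ℕ) : ℝ)) := by
    rw [ht₃]
    have := hk0.ne'
    field_simp
    ring
  have e₂ : 0 ≤ d ^ 2 / 32 * t₂ := by positivity
  linarith
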